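/- Let $k$ be an algebraically closed field of characteristic $p \ge 3$ and let $q \ge 5$ be a power of $p$. For an irreducible plane curve $C \subset \mathbb{P}^2$ over $k$ with function field $k(C)$ and a point $P \in \mathbb{P}^2$, let $\pi_P$ be the projection from $P$. The point $P$ is called a Galois point for $C$ if the extension $k(C)/\pi_P^* k(\mathbb{P}^1)$ is Galois, and then $G_P$ denotes its Galois group; a Galois point that is a smooth point of $C$ is called inner. Let $D_{q-1}$ denote the dihedral group of order $q-1$. Let $C_2$ be the image of the morphism $$\varphi_2 : \mathbb{P}^1 \to \mathbb{P}^2,\quad (s:t) \mapsto \left(s^{\frac{q+1}{2}}t^{\frac{q-1}{2}} : (s-t)^{\frac{q+1}{2}}t^{\frac{q-1}{2}} : s^q - st^{q-1}\right).$$ Then $C_2$ is an irreducible plane curve of degree $q$, and: (a) The point $P_1 := (0:1:0) = \varphi_2(0:1)$ is an inner Galois point for $C_2$ with $G_{P_1} \cong D_{q-1}$. (b) The point $P_2 := (1:0:0) = \varphi_2(1:1)$ is an inner Galois point for $C_2$ with $G_{P_2} \cong D_{q-1}$. (c) The number of inner Galois points for $C_2$ is exactly two; that is, $P_1$ and $P_2$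 are the only ones. -/

import Mathlib

noncomputable section

/-- An irreducible plane curve `C ⊂ ℙ²` over `k`, given by an irreducible homogeneous polynomial
in three variables. -/
structure PlaneCurve (k : Type*) [Field k] where
  /-- the defining polynomial -/
  poly : MvPolynomial (Fin 3) k
  homogeneous : poly.IsHomogeneous poly.totalDegree
  irreducible : Irreducible poly

namespace PlaneCurve

variable {k : Type*} [Field k] (C : PlaneCurve k)

/-- The degree of the plane curve. -/
def degree : ℕ := C.poly.totalDegree

/-- The set of points of `C` in `ℙ²(k)` (independent of the representatives, as the polynomial
is homogeneous). -/
def points : Set (Projectivization k (Fin 3 → k)) :=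
  {P | MvPolynomial.eval P.rep C.poly = 0}

/-- `P` is a smooth point of `C`: it lies on `C`, and some partial derivative of the defining
polynomial does not vanish at `P`. -/
def IsSmoothPoint (P : Projectivization k (Fin 3 → k)) : Prop :=
  P ∈ C.points ∧ ∃ i : Fin 3, MvPolynomial.eval P.rep (MvPolynomial.pderiv i C.poly) ≠ 0

/-- The homogeneous coordinate ring `k[X, Y, Z] / (F)`. -/
abbrev CoordRing : Type _ := MvPolynomial (Fin 3) k ⧸ Ideal.span {C.poly}

instance : IsDomain C.CoordRing := by
  have h : (Ideal.span {C.poly}).IsPrime :=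
    (Ideal.span_singleton_prime C.irreducible.ne_zero).2 C.irreducible.prime
  exact Ideal.Quotient.isDomain _

/-- The field of fractions of the homogeneous coordinate ring. It contains the function field
of `C` as its part of degree zero. -/
abbrev ConeField : Type _ := FractionRing C.CoordRing

/-- The class of a polynomial in the field of fractions of the homogeneous coordinate ring. -/
def toConeField : MvPolynomial (Fin 3) k →ₐ[k] C.ConeField :=
  (IsScalarTower.toAlgHom k C.CoordRing C.ConeField).comp
    (Ideal.Quotient.mkₐ k (Ideal.span {C.poly}))

/-- The function field `k(C)`: the quotients `a / b` of homogeneous polynomials `a`, `b` of the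
same degree, restricted to `C`, where `b` does not vanish identically on `C`. -/
def functionField : IntermediateField k C.ConeField where
  carrier := {x | ∃ (d : ℕ) (a b : MvPolynomial (Fin 3) k), a.IsHomogeneous d ∧
    b.IsHomogeneous d ∧ C.toConeField b ≠ 0 ∧ x = C.toConeField a / C.toConeField b}
  mul_mem' := by
    rintro _ _ ⟨d, a, b, ha, hb, hb0, rfl⟩ ⟨e, a', b', ha', hb', hb0', rfl⟩
    refine ⟨d + e, a * a', b * b', ha.mul ha', hb.mul hb', ?_, ?_⟩
    · rw [map_mul]; exact mul_ne_zero hb0 hb0'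
    · rw [map_mul, map_mul, div_mul_div_comm]
  add_mem' := by
    rintro _ _ ⟨d, a, b, ha, hb, hb0, rfl⟩ ⟨e, a', b', ha', hb', hb0', rfl⟩
    refine ⟨d + e, a * b' + b * a', b * b', (ha.mul hb').add (hb.mul ha'), hb.mul hb', ?_, ?_⟩
    · rw [map_mul]; exact mul_ne_zero hb0 hb0'
    · rw [map_add, map_mul, map_mul, map_mul, div_add_div _ _ hb0 hb0']
  algebraMap_mem' := by
    intro r
    refine ⟨0, MvPolynomial.C r, 1, MvPolynomial.isHomogeneous_C _ r,
      MvPolynomial.isHomogeneous_one _ _, ?_, ?_⟩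
    · rw [map_one]; exact one_ne_zero
    · rw [map_one, div_one]; exact (C.toConeField.commutes r).symm
  inv_mem' := by
    rintro _ ⟨d, a, b, ha, hb, hb0, rfl⟩
    by_cases h : C.toConeField a = 0
    · refine ⟨d, a, b, ha, hb, hb0, ?_⟩
      rw [h, zero_div, inv_zero]
    · exact ⟨d, b, a, hb, ha, h, inv_div _ _⟩

/-- The subfield `π_P^* k(ℙ¹)` of `k(C)`, where `π_P` is the projection from the point `P`. The
projection is `R ↦ (ℓ(R) : ℓ'(R))` for a basis `ℓ`, `ℓ'` of the space of linear forms vanishing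
at `P`, so that the subfield is generated over `k` by the quotients of such forms. -/
def projectionField (P : Projectivization k (Fin 3 → k)) :
    IntermediateField k C.functionField :=
  IntermediateField.adjoin k {x | ∃ a b : MvPolynomial (Fin 3) k, a.IsHomogeneous 1 ∧
    b.IsHomogeneous 1 ∧ MvPolynomial.eval P.rep a = 0 ∧ MvPolynomial.eval P.rep b = 0 ∧
    C.toConeField b ≠ 0 ∧ (x : C.ConeField) = C.toConeField a / C.toConeField b}

/-- `P` is a Galois point for `C`: the extension `k(C) / π_P^* k(ℙ¹)` is Galois. -/
def IsGaloisPoint (P : Projectivization k (Fin 3 → k)) : Prop :=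
  IsGalois (C.projectionField P) C.functionField

/-- `P` is an inner Galois point for `C`: a Galois point that is a smooth point of `C`. -/
def IsInnerGaloisPoint (P : Projectivization k (Fin 3 → k)) : Prop :=
  C.IsGaloisPoint P ∧ C.IsSmoothPoint P

/-- The Galois group `G_P` of the extension `k(C) / π_P^* k(ℙ¹)`. -/
abbrev GaloisGroup (P : Projectivization k (Fin 3 → k)) : Type _ :=
  C.functionField ≃ₐ[C.projectionField P] C.functionField

end PlaneCurve

/-- A power of a prime `p ≥ 3` is odd. -/
theorem odd_of_eq_prime_pow {p q : ℕ} (hp : p.Prime) (hp3 : 3 ≤ p)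
    (hq : ∃ n : ℕ, q = p ^ n) : Odd q := by
  obtain ⟨n, rfl⟩ := hq
  exact (hp.odd_of_ne_two (by omega)).pow

section Parametrization

variable {k : Type*} [Field k]

/-- The coordinates of the parametrization `φ₂` at `(s, t) = (v 0, v 1)`. -/
def phi2Vec (q : ℕ) (v : Fin 2 → k) : Fin 3 → k :=
  ![v 0 ^ ((q + 1) / 2) * v 1 ^ ((q - 1) / 2),
    (v 0 - v 1) ^ ((q + 1) / 2) * v 1 ^ ((q - 1) / 2),
    v 0 ^ q - v 0 * v 1 ^ (q - 1)]

theorem phi2Vec_smul {q : ℕ} (hq : Odd q) (c : k) (v : Fin 2 → k) :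
    phi2Vec q (c • v) = c ^ q • phi2Vec q v := by
  obtain ⟨m, rfl⟩ := hq
  have h1 : (2 * m + 1 + 1) / 2 = m + 1 := by omega
  funext i
  fin_cases i
  · simp [phi2Vec, h1]; ring
  · simp [phi2Vec, h1, ← mul_sub, mul_pow]; ring
  · simp [phi2Vec]; ring

theorem phi2Vec_ne_zero {q : ℕ} (hq : Odd q) {v : Fin 2 → k} (hv : v ≠ 0) :
    phi2Vec q v ≠ 0 := by
  obtain ⟨m, rfl⟩ := hq
  have h1 : (2 * m + 1 + 1) / 2 = m + 1 := by omega
  have h2 : (2 * m + 1 - 1) / 2 = m := by omega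
  intro h
  have hX : v 0 ^ (m + 1) * v 1 ^ m = 0 := by simpa [phi2Vec, h1, h2] using congrFun h 0
  have hY : (v 0 - v 1) ^ (m + 1) * v 1 ^ m = 0 := by
    simpa [phi2Vec, h1, h2] using congrFun h 1
  have hZ : v 0 ^ (2 * m + 1) - v 0 * v 1 ^ (2 * m) = 0 := by
    simpa [phi2Vec] using congrFun h 2
  have key : v 0 = 0 ∧ v 1 = 0 := by
    by_cases ht : v 1 = 0
    · refine ⟨?_, ht⟩
      rcases Nat.eq_zero_or_pos m with rfl | hm
      · simpa using hX
      · rw [ht, zero_pow (by omega), mul_zero, sub_zero] at hZ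
        exact eq_zero_of_pow_eq_zero hZ
    · have hs : v 0 = 0 :=
        eq_zero_of_pow_eq_zero ((mul_eq_zero.1 hX).resolve_right (pow_ne_zero _ ht))
      have hst : v 0 - v 1 = 0 :=
        eq_zero_of_pow_eq_zero ((mul_eq_zero.1 hY).resolve_right (pow_ne_zero _ ht))
      exact ⟨hs, by rw [hs, zero_sub, neg_eq_zero] at hst; exact hst⟩
  apply hv
  funext i
  fin_cases i
  · exact key.1
  · exact key.2

/-- The morphism `φ₂ : ℙ¹ → ℙ²`,
`(s : t) ↦ (s^((q+1)/2) t^((q-1)/2) : (s-t)^((q+1)/2) t^((q-1)/2) : s^q - s t^(q-1))`. -/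
def phi2 {q : ℕ} (hq : Odd q) :
    Projectivization k (Fin 2 → k) → Projectivization k (Fin 3 → k) :=
  Projectivization.lift
    (fun v => Projectivization.mk k (phi2Vec q v.1) (phi2Vec_ne_zero hq v.2))
    (by
      rintro ⟨a, ha⟩ ⟨b, hb⟩ c h
      have h' : a = c • b := h
      rw [Projectivization.mk_eq_mk_iff']
      exact ⟨c ^ q, by subst h'; exact (phi2Vec_smul hq c b).symm⟩)

variable (k)

/-- The point `(0 : 1)` of `ℙ¹`. -/
def pt01 : Projectivization k (Fin 2 → k) :=
  Projectivization.mk k ![0, 1] (by simp)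

/-- The point `(1 : 1)` of `ℙ¹`. -/
def pt11 : Projectivization k (Fin 2 → k) :=
  Projectivization.mk k ![1, 1] (by simp)

/-- The point `(0 : 1 : 0)` of `ℙ²`. -/
def pt010 : Projectivization k (Fin 3 → k) :=
  Projectivization.mk k ![0, 1, 0] (by simp)

/-- The point `(1 : 0 : 0)` of `ℙ²`. -/
def pt100 : Projectivization k (Fin 3 → k) :=
  Projectivization.mk k ![1, 0, 0] (by simp)

end Parametrization

end

/-! Write `q = 2m + 1` and use the affine coordinate `s` (`t = 1`), so that the curve is
parametrized by `(s^(m+1) : (s-1)^(m+1) : s^q - s)`.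

The Galois points. Projection from `(0:1:0)` is `s^(m+1) / (s^q - s) = w / (w^2 - 1)` with `w =
s^m`. It is invariant under `s ↦ ζ s` for `ζ^m = 1` and under `s ↦ η / s` for `η^m = -1`, because `w
↦ -1/w` preserves `w / (w^2 - 1)`. These substitutions form a dihedral group of order `2m`, which is
the degree of the map, so the extension is Galois with that group (`isGalois_zero_div_two`). Since
`s^q - s` is invariant under `s ↦ s - 1`, translation carries this projection to the one from
`(1:0:0)` (`isGalois_one_div_two`).

The curve. The degree of the parametrization onto its image divides both `2m` (the projection above)
and `2m + 1` (a quotient of linear forms without cancellation), hence is 1 (`adjoin_eq_top`), and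
the function field is `k(s)`. The kernel of the substitution of forms is principal by a dimension
count (`ker_paramHom_eq_span`), and the parametrization is onto the zero locus because it is
integral (`paramHom_isIntegral`). Degrees of projections control the degree of the equation in one
variable from above (`degreeOf_shear_poly_le`) and below (`finrank_adjoin_le_degreeOf`). This gives
degree `q` (`totalDegree_poly`) and decides which points are smooth.

No other inner Galois points. The point `t = 0` is singular. At any other point, normalized to `(1 :
b : c)` with `b ≠ 0`, the projection is `f / g` with `f = (s-1)^(m+1) - b s^(m+1)` separable of
degree at most `m + 1` and `deg g = 2m + 1`. If every root of `f` is a root of `g`, then `f ∣ g` and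
the projection has degree at most `m + 1 < 2m`, which is impossible at a smooth point. Otherwise `f
/ g` has a simple zero on the affine line and a zero of order at least `m ≥ 2` at infinity; unequal
ramification in one fibre excludes a Galois extension (`not_isGalois_of_simple_zero`). -/

section RationalFunctions

open Polynomial IntermediateField

variable {k : Type*} [Field k]

/-! ### Degrees of subfields of `k(X)`, and the dihedral action on it. -/

namespace RatFunc

/-- The gcd is a unit, so passing to the normalized numerator only rescales by constants. With the
analogue for denominators this lets the degree of `k(X)` over `k(p/q)` be read off any coprime
representation. -/
theorem natDegree_num_div_of_isCoprime {p q : k[X]} (h : IsCoprime p q) (hq : q ≠ 0) :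
    (algebraMap k[X] (RatFunc k) p / algebraMap k[X] (RatFunc k) q).num.natDegree =
      p.natDegree := by
  classical
  have hu : IsUnit (gcd p q) := by
    rw [gcd_isUnit_iff]; exact h
  obtain ⟨u, hu0, hu⟩ := Polynomial.isUnit_iff.1 hu
  rw [num_div, ← hu, Polynomial.div_C, Polynomial.div_C,
    natDegree_C_mul, natDegree_mul_C (inv_ne_zero hu0.ne_zero)]
  apply inv_ne_zero
  rw [leadingCoeff_ne_zero]
  exact mul_ne_zero hq (by simpa using hu0.ne_zero)

theorem natDegree_denom_div_of_isCoprime {p q : k[X]} (h : IsCoprime p q) (hq : q ≠ 0) :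
    (algebraMap k[X] (RatFunc k) p / algebraMap k[X] (RatFunc k) q).denom.natDegree =
      q.natDegree := by
  classical
  have hu : IsUnit (gcd p q) := by
    rw [gcd_isUnit_iff]; exact h
  obtain ⟨u, hu0, hu⟩ := Polynomial.isUnit_iff.1 hu
  rw [denom_div _ hq, ← hu, Polynomial.div_C,
    natDegree_C_mul, natDegree_mul_C (inv_ne_zero hu0.ne_zero)]
  apply inv_ne_zero
  rw [leadingCoeff_ne_zero]
  exact mul_ne_zero hq (by simpa using hu0.ne_zero)

theorem finrank_adjoin_div {p q : k[X]} (h : IsCoprime p q) (hq : q ≠ 0) :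
    Module.finrank k⟮algebraMap k[X] (RatFunc k) p / algebraMap k[X] (RatFunc k) q⟯ (RatFunc k) =
      max p.natDegree q.natDegree := by
  rw [finrank_eq_max_natDegree, natDegree_num_div_of_isCoprime h hq,
    natDegree_denom_div_of_isCoprime h hq]

theorem transcendental_div {p q : k[X]} (h : IsCoprime p q) (hq : q ≠ 0)
    (hpos : 0 < max p.natDegree q.natDegree) :
    Transcendental k (algebraMap k[X] (RatFunc k) p / algebraMap k[X] (RatFunc k) q) := by
  apply transcendental_of_ne_C
  rw [eq_C_iff, natDegree_num_div_of_isCoprime h hq, natDegree_denom_div_of_isCoprime h hq]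
  omega

theorem algHom_ext_X {A : Type*} [Field A] [Algebra k A] {φ ψ : RatFunc k →ₐ[k] A}
    (h : φ X = ψ X) : φ = ψ := by
  have key : ∀ p : k[X], φ (algebraMap k[X] _ p) = ψ (algebraMap k[X] _ p) := by
    intro p
    have : (φ.comp (IsScalarTower.toAlgHom k k[X] (RatFunc k))) =
        (ψ.comp (IsScalarTower.toAlgHom k k[X] (RatFunc k))) := by
      apply Polynomial.algHom_ext
      simpa using h
    simpa using DFunLike.congr_fun this p
  ext f
  rw [← num_div_denom f, map_div₀, map_div₀, key, key]

/-- The substitution `X ↦ g`, for `g` transcendental. -/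
noncomputable def subst {A : Type*} [Field A] [Algebra k A] (g : A) (hg : Transcendental k g) :
    RatFunc k →ₐ[k] A :=
  liftAlgHom (aeval g)
    (nonZeroDivisors_le_comap_nonZeroDivisors_of_injective _ (transcendental_iff_injective.1 hg))

@[simp]
theorem subst_algebraMap {A : Type*} [Field A] [Algebra k A] (g : A) (hg : Transcendental k g)
    (p : k[X]) : subst g hg (algebraMap k[X] _ p) = aeval g p := by
  rw [subst]
  simpa using liftAlgHom_apply_div (aeval g) (nonZeroDivisors_le_comap_nonZeroDivisors_of_injective
    _ (transcendental_iff_injective.1 hg)) p 1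

@[simp]
theorem subst_X {A : Type*} [Field A] [Algebra k A] (g : A) (hg : Transcendental k g) :
    subst g hg X = g := by
  rw [← algebraMap_X, subst_algebraMap, aeval_X]

theorem transcendental_C_mul_X {c : k} (hc : c ≠ 0) :
    Transcendental k (C c * X : RatFunc k) := by
  have h := transcendental_div (p := Polynomial.C c * Polynomial.X) (q := 1) isCoprime_one_right
    one_ne_zero (by simp [natDegree_C_mul_X _ hc])
  rwa [map_mul, algebraMap_X, algebraMap_C, map_one, div_one] at h

theorem transcendental_C_div_X {c : k} (hc : c ≠ 0) :
    Transcendental k (C c / X : RatFunc k) := by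
  have h := transcendental_div (p := Polynomial.C c) (q := Polynomial.X)
    ((isCoprime_mul_unit_left_left (Polynomial.isUnit_C.2 hc.isUnit) 1 Polynomial.X).2
      isCoprime_one_left |> (by simpa using ·)) Polynomial.X_ne_zero (by simp)
  rwa [algebraMap_X, algebraMap_C] at h

theorem transcendental_X_sub_C (c : k) :
    Transcendental k (X - C c : RatFunc k) := by
  have h := transcendental_div (p := Polynomial.X - Polynomial.C c) (q := 1) isCoprime_one_right
    one_ne_zero (by simp)
  rwa [map_sub, algebraMap_X, algebraMap_C, map_one, div_one] at h

/-- The translation `X ↦ X - c` of the field of rational functions. -/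
noncomputable def translate (c : k) : RatFunc k ≃ₐ[k] RatFunc k :=
  AlgEquiv.ofAlgHom (subst _ (transcendental_X_sub_C c)) (subst _ (transcendental_X_sub_C (-c)))
    (algHom_ext_X (by simp [← algebraMap_eq_C]))
    (algHom_ext_X (by simp [← algebraMap_eq_C]))

@[simp]
theorem translate_algebraMap (c : k) (p : k[X]) :
    translate c (algebraMap k[X] _ p) =
      algebraMap k[X] _ (p.comp (Polynomial.X - Polynomial.C c)) := by
  change subst _ (transcendental_X_sub_C c) _ = _
  rw [subst_algebraMap, ← algebraMap_X, ← algebraMap_C, ← map_sub]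
  rw [Polynomial.aeval_algebraMap_apply]
  rw [comp_eq_aeval]

/-- The action of the dihedral group of order `2m` on the rational functions: the rotations act by
`X ↦ ζ ^ i X` and the reflections by `X ↦ η ζ ^ i / X`. -/
noncomputable def dihedralHom {m : ℕ} [NeZero m] {ζ η : k} (hζ : IsPrimitiveRoot ζ m) (hη : η ≠ 0) :
    DihedralGroup m →* (RatFunc k →ₐ[k] RatFunc k) where
  toFun
    | .r i => subst (C (ζ ^ i.val) * X)
        (transcendental_C_mul_X (pow_ne_zero _ (hζ.ne_zero (NeZero.ne m))))
    | .sr i => subst (C (η * ζ ^ i.val) / X)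
        (transcendental_C_div_X (mul_ne_zero hη (pow_ne_zero _ (hζ.ne_zero (NeZero.ne m)))))
  map_one' := by
    rw [DihedralGroup.one_def]
    apply algHom_ext_X
    simp
  map_mul' := by
    have hζ0 := hζ.ne_zero (NeZero.ne m)
    have hadd : ∀ i j : ZMod m, ζ ^ (i + j).val = ζ ^ i.val * ζ ^ j.val := by
      intro i j
      rw [ZMod.val_add, ← pow_add, ← pow_mod_orderOf ζ (i.val + j.val), ← hζ.eq_orderOf]
    have hsub : ∀ i j : ZMod m, ζ ^ (j - i).val = ζ ^ j.val / ζ ^ i.val := by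
      intro i j
      rw [eq_div_iff (pow_ne_zero _ hζ0), ← hadd, sub_add_cancel]
    have hX : (X : RatFunc k) ≠ 0 := X_ne_zero
    have hC : ∀ i : ZMod m, (C ζ : RatFunc k) ^ i.val ≠ 0 := fun i =>
      pow_ne_zero _ (by simpa using hζ0)
    have hCη : (C η : RatFunc k) ≠ 0 := by simpa using hη
    have hcomm : ∀ (φ : RatFunc k →ₐ[k] RatFunc k) (c : k), φ (C c) = C c := by
      intro φ c
      rw [← algebraMap_eq_C]
      exact φ.commutes c
    rintro (i | i) (j | j)
    · rw [DihedralGroup.r_mul_r]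
      apply algHom_ext_X
      simp only [AlgHom.mul_apply, subst_X, map_mul, hcomm, hadd, map_pow]
      ring
    · rw [DihedralGroup.r_mul_sr]
      apply algHom_ext_X
      simp only [AlgHom.mul_apply, subst_X, map_mul, map_div₀, hcomm, hsub, map_pow]
      have := hC i
      field_simp
    · rw [DihedralGroup.sr_mul_r]
      apply algHom_ext_X
      simp only [AlgHom.mul_apply, subst_X, map_mul, hcomm, hadd, map_pow]
      ring
    · rw [DihedralGroup.sr_mul_sr]
      apply algHom_ext_X
      simp only [AlgHom.mul_apply, subst_X, map_mul, map_div₀, hcomm, hsub, map_pow]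
      have := hC i
      field_simp

theorem dihedralHom_r_X {m : ℕ} [NeZero m] {ζ η : k} (hζ : IsPrimitiveRoot ζ m) (hη : η ≠ 0)
    (i : ZMod m) : dihedralHom hζ hη (.r i) X = C (ζ ^ i.val) * X :=
  subst_X _ (transcendental_C_mul_X (pow_ne_zero _ (hζ.ne_zero (NeZero.ne m))))

theorem dihedralHom_sr_X {m : ℕ} [NeZero m] {ζ η : k} (hζ : IsPrimitiveRoot ζ m) (hη : η ≠ 0)
    (i : ZMod m) : dihedralHom hζ hη (.sr i) X = C (η * ζ ^ i.val) / X :=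
  subst_X _ (transcendental_C_div_X
    (mul_ne_zero hη (pow_ne_zero _ (hζ.ne_zero (NeZero.ne m)))))

theorem dihedralHom_injective {m : ℕ} [NeZero m] {ζ η : k} (hζ : IsPrimitiveRoot ζ m)
    (hη : η ≠ 0) : Function.Injective (dihedralHom hζ hη) := by
  rw [injective_iff_map_eq_one]
  have hX : (X : RatFunc k) ≠ 0 := X_ne_zero
  rintro (i | i) h
  · have h1 := DFunLike.congr_fun h X
    rw [dihedralHom_r_X, AlgHom.one_apply, mul_eq_right₀ hX, ← map_one C] at h1
    have h2 : ζ ^ i.val = 1 := C_injective h1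
    have h3 : i = 0 := by
      rw [← ZMod.val_eq_zero]
      exact Nat.eq_zero_of_dvd_of_lt (hζ.dvd_of_pow_eq_one _ h2) (ZMod.val_lt i)
    rw [h3, DihedralGroup.one_def]
  · exfalso
    have h1 := DFunLike.congr_fun h X
    rw [dihedralHom_sr_X, AlgHom.one_apply, div_eq_iff hX, ← algebraMap_C, ← algebraMap_X,
      ← map_mul] at h1
    have h2 := congrArg natDegree (algebraMap_injective k h1)
    rw [natDegree_C, natDegree_mul Polynomial.X_ne_zero Polynomial.X_ne_zero, natDegree_X] at h2
    omega

end RatFunc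

/-- A finite group acting faithfully by automorphisms over `F`, of order the degree of the
extension, is its Galois group. -/
theorem isGalois_of_injective_of_card_eq_finrank {k E G : Type*} [Field k] [Field E] [Algebra k E]
    [Group G] (F : IntermediateField k E) (hpos : 0 < Module.finrank F E)
    (ρ : G →* (E →ₐ[k] E)) (hρ : Function.Injective ρ)
    (hfix : ∀ g, ∀ x ∈ F, ρ g x = x) (hcard : Nat.card G = Module.finrank F E) :
    IsGalois F E ∧ Nonempty ((E ≃ₐ[F] E) ≃* G) := by
  -- `finrank` is 0 for infinite extensions, so positivity carries finiteness; the same convention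
  -- for `Nat.card` makes `G` finite below.
  have : FiniteDimensional F E := Module.finite_of_finrank_pos hpos
  let ρ₁ : G →* (E ≃ₐ[k] E) := (AlgEquiv.algHomUnitsEquiv k E).toMonoidHom.comp ρ.toHomUnits
  have h₁ : ∀ g x, ρ₁ g x = ρ g x := fun g x => rfl
  let ρ₂ : G →* F.fixingSubgroup := ρ₁.codRestrict F.fixingSubgroup (by
    intro g
    rw [IntermediateField.mem_fixingSubgroup_iff]
    intro x hx
    rw [h₁, hfix g x hx])
  let ρ₃ : G →* (E ≃ₐ[F] E) := (IntermediateField.fixingSubgroupEquiv F).toMonoidHom.comp ρ₂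
  have h₃ : ∀ g x, ρ₃ g x = ρ g x := fun g x => rfl
  have inj : Function.Injective ρ₃ := by
    intro g h hgh
    apply hρ
    ext x
    rw [← h₃, ← h₃, hgh]
  have : Finite G := Nat.finite_of_card_ne_zero (by omega)
  have hle : Nat.card (E ≃ₐ[F] E) ≤ Nat.card G := by
    rw [hcard, Nat.card_eq_fintype_card]
    exact AlgEquiv.card_le
  have bij : Function.Bijective ρ₃ := (Nat.bijective_iff_injective_and_card ρ₃).2
    ⟨inj, le_antisymm (Nat.card_le_card_of_injective ρ₃ inj) hle⟩
  refine ⟨?_, ⟨(MulEquiv.ofBijective ρ₃ bij).symm⟩⟩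
  apply IsGalois.of_card_aut_eq_finrank
  rw [← hcard, Nat.card_congr (Equiv.ofBijective ρ₃ bij)]

/-- An isomorphism of fields carries a Galois extension to a Galois extension with the same
group. -/
theorem IntermediateField.galois_map_algEquiv {k K E : Type*} [Field k] [Field K] [Field E]
    [Algebra k K] [Algebra k E] (e : K ≃ₐ[k] E) {F : IntermediateField k K}
    {F' : IntermediateField k E} (h : F.map e.toAlgHom = F') :
    (IsGalois F K ↔ IsGalois F' E) ∧ Nonempty ((K ≃ₐ[F] K) ≃* (E ≃ₐ[F'] E)) := by
  subst h
  let f : F ≃+* F.map e.toAlgHom := (F.intermediateFieldMap e).toRingEquiv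
  have hf : ∀ x : F, (f x : E) = e x := fun x => rfl
  have hf' : ∀ x, (f.symm x : K) = e.symm x := by
    intro x
    rw [e.eq_symm_apply, ← hf, f.apply_symm_apply]
  refine ⟨⟨fun _ => IsGalois.of_equiv_equiv (f := f) (g := e.toRingEquiv) ?_,
    fun _ => IsGalois.of_equiv_equiv (f := f.symm) (g := e.symm.toRingEquiv) ?_⟩, ⟨?_⟩⟩
  · ext x; rfl
  · ext x
    exact (hf' x).symm
  · exact
    { toFun := fun σ => AlgEquiv.ofRingEquiv
        (f := (e.symm.toRingEquiv.trans σ.toRingEquiv).trans e.toRingEquiv) (by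
          intro x
          change e (σ (e.symm (x : E))) = x
          rw [← hf' x]
          have : σ (f.symm x : K) = (f.symm x : K) := σ.commutes (f.symm x)
          rw [this, hf', e.apply_symm_apply])
      invFun := fun σ => AlgEquiv.ofRingEquiv
        (f := (e.toRingEquiv.trans σ.toRingEquiv).trans e.symm.toRingEquiv) (by
          intro x
          change e.symm (σ (e (x : K))) = x
          rw [← hf x]
          have : σ (f x : E) = (f x : E) := σ.commutes (f x)
          rw [this, hf, e.symm_apply_apply])
      left_inv := by
        intro σ
        ext x
        change e.symm (e (σ (e.symm (e x)))) = σ x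
        simp
      right_inv := by
        intro σ
        ext x
        change e (e.symm (σ (e (e.symm x)))) = σ x
        simp
      map_mul' := by
        intro σ τ
        ext x
        change e (σ (τ (e.symm x))) = e (σ (e.symm (e (τ (e.symm x)))))
        simp }

end RationalFunctions

/-! ### The two projections in the affine coordinate, and birationality of the parametrization. -/

section AffineParametrization

open Polynomial IntermediateField

/-- The odd number `q = 2m + 1 ≥ 5` behaves like a power of the characteristic of `k`. -/
structure IsFrobeniusIndex (k : Type*) [Field k] (m : ℕ) : Prop where
  two_le : 2 ≤ m
  natCast_eq_zero : (2 * m + 1 : k) = 0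
  sub_one_pow : (X - 1 : k[X]) ^ (2 * m + 1) = X ^ (2 * m + 1) - 1

variable (k : Type*) [Field k]

/-- The coordinates of the parametrization `φ₂` in the affine coordinate `s` of the line. -/
noncomputable def affineParam (m : ℕ) : Fin 3 → k[X] :=
  ![X ^ (m + 1), (X - 1) ^ (m + 1), X ^ (2 * m + 1) - X]

variable {k} {m : ℕ}

@[simp] theorem affineParam_zero : affineParam k m 0 = X ^ (m + 1) := rfl

@[simp] theorem affineParam_one : affineParam k m 1 = (X - 1) ^ (m + 1) := rfl

@[simp] theorem affineParam_two : affineParam k m 2 = X ^ (2 * m + 1) - X := rfl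

/-- The projection from `(0 : 1 : 0)` in reduced form. -/
theorem affineParam_zero_div_two : algebraMap k[X] (RatFunc k) (X ^ (m + 1)) /
      algebraMap k[X] (RatFunc k) (X ^ (2 * m + 1) - X) =
    algebraMap k[X] (RatFunc k) (X ^ m) / algebraMap k[X] (RatFunc k) (X ^ (2 * m) - 1) := by
  have h1 : (X ^ (m + 1) : k[X]) = X * X ^ m := by ring
  have h2 : (X ^ (2 * m + 1) - X : k[X]) = X * (X ^ (2 * m) - 1) := by ring
  rw [h1, h2, map_mul, map_mul, mul_div_mul_left]
  exact RatFunc.algebraMap_ne_zero X_ne_zero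

theorem natDegree_sub_one_pow_sub_le (c : k) :
    ((X - 1) ^ (m + 1) - C c * X ^ (m + 1) : k[X]).natDegree ≤ m + 1 := by
  apply (natDegree_sub_le _ _).trans
  apply max_le
  · rw [← C_1, natDegree_pow, natDegree_X_sub_C, mul_one]
  · exact natDegree_C_mul_X_pow_le _ _

namespace IsFrobeniusIndex

variable (hm : IsFrobeniusIndex k m)
include hm

theorem neZero : NeZero m := ⟨by have := hm.two_le; omega⟩

theorem cast_ne_zero : (m : k) ≠ 0 := by
  intro h
  have := hm.natCast_eq_zero
  rw [h] at this
  simp at this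

theorem two_ne_zero : (2 : k) ≠ 0 := by
  intro h
  have := hm.natCast_eq_zero
  rw [h] at this
  simp at this

theorem cast_add_one_ne_zero : (m + 1 : k) ≠ 0 := by
  intro h
  have h1 := hm.natCast_eq_zero
  have : (2 * (m + 1) - (2 * m + 1) : k) = 0 := by rw [h, h1]; simp
  ring_nf at this
  exact one_ne_zero this

/-- Invariance of `X^q - X` under `X ↦ X - 1`; this symmetry relates the two Galois points. -/
theorem affineParam_two_eq_sub_one :
    (X ^ (2 * m + 1) - X : k[X]) = (X - 1) ^ (2 * m + 1) - (X - 1) := by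
  rw [hm.sub_one_pow]
  ring

theorem natDegree_affineParam_two : (X ^ (2 * m + 1) - X : k[X]).natDegree = 2 * m + 1 := by
  have := hm.two_le
  rw [natDegree_sub_eq_left_of_natDegree_lt] <;> simp
  omega

theorem affineParam_two_ne_zero : (X ^ (2 * m + 1) - X : k[X]) ≠ 0 := by
  intro h
  have := hm.natDegree_affineParam_two
  rw [h] at this
  simp at this

theorem finrank_zero_div_two : Module.finrank k⟮algebraMap k[X] (RatFunc k) (X ^ (m + 1)) /
      algebraMap k[X] (RatFunc k) (X ^ (2 * m + 1) - X)⟯ (RatFunc k) = 2 * m := by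
  have := hm.two_le
  have hd : (X ^ (2 * m) - 1 : k[X]).natDegree = 2 * m := by
    rw [← C_1]; exact natDegree_X_pow_sub_C
  rw [affineParam_zero_div_two, RatFunc.finrank_adjoin_div, hd, natDegree_X_pow]
  · omega
  · refine ⟨X ^ m, -1, ?_⟩
    ring
  · intro h
    rw [h, natDegree_zero] at hd
    omega

/-- The generator is `w / (w^2 - 1)` with `w = X^m`: rotations fix `w` and reflections send `w` to
`-1/w`. The dihedral group has order `2m`, the degree of the extension. -/
theorem isGalois_zero_div_two [IsAlgClosed k] :
    IsGalois k⟮algebraMap k[X] (RatFunc k) (X ^ (m + 1)) /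
      algebraMap k[X] (RatFunc k) (X ^ (2 * m + 1) - X)⟯ (RatFunc k) ∧
    Nonempty ((RatFunc k ≃ₐ[k⟮algebraMap k[X] (RatFunc k) (X ^ (m + 1)) /
      algebraMap k[X] (RatFunc k) (X ^ (2 * m + 1) - X)⟯] RatFunc k) ≃* DihedralGroup m) := by
  have := hm.two_le
  have := hm.neZero
  have : NeZero (m : k) := ⟨hm.cast_ne_zero⟩
  obtain ⟨ζ, hζ⟩ := HasEnoughRootsOfUnity.exists_primitiveRoot k m
  -- The sign in `η^m = -1` is what makes a reflection act by `w ↦ -1/w` and not by `w ↦ 1/w`, which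
  -- would negate the generator.
  obtain ⟨η, hη⟩ := IsAlgClosed.exists_pow_nat_eq (-1 : k) (n := m) (by omega)
  have hη0 : η ≠ 0 := by
    rintro rfl
    rw [zero_pow (by omega)] at hη
    simp at hη
  apply isGalois_of_injective_of_card_eq_finrank _ _ (RatFunc.dihedralHom hζ hη0)
    (RatFunc.dihedralHom_injective hζ hη0)
  · have key : ∀ g, RatFunc.dihedralHom hζ hη0 g (algebraMap k[X] (RatFunc k) (X ^ (m + 1)) /
        algebraMap k[X] (RatFunc k) (X ^ (2 * m + 1) - X)) =
        algebraMap k[X] (RatFunc k) (X ^ (m + 1)) /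
        algebraMap k[X] (RatFunc k) (X ^ (2 * m + 1) - X) := by
      intro g
      rw [affineParam_zero_div_two]
      simp only [map_div₀, map_sub, map_pow, map_one, RatFunc.algebraMap_X]
      have hX : (RatFunc.X : RatFunc k) ≠ 0 := RatFunc.X_ne_zero
      have hζi : ∀ i : ZMod m, ((RatFunc.C ζ : RatFunc k) ^ i.val) ^ m = 1 := by
        intro i
        rw [← pow_mul, mul_comm, pow_mul, ← map_pow, hζ.pow_eq_one, map_one, one_pow]
      rcases g with i | i
      · rw [RatFunc.dihedralHom_r_X, map_pow, mul_pow, mul_comm 2 m, pow_mul, mul_pow, hζi, one_mul,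
          pow_mul]
      · rw [RatFunc.dihedralHom_sr_X, map_mul, map_pow, mul_comm 2 m, pow_mul, div_pow, mul_pow,
          hζi, ← map_pow, hη, pow_mul]
        simp only [map_neg, map_one, mul_one]
        have hd : (algebraMap k[X] (RatFunc k)) (X ^ (2 * m) - 1) ≠ 0 := by
          apply RatFunc.algebraMap_ne_zero
          rw [← C_1]
          exact X_pow_sub_C_ne_zero (by omega) _
        rw [map_sub, map_pow, map_one, RatFunc.algebraMap_X, mul_comm 2 m, pow_mul] at hd
        have hXm : (RatFunc.X : RatFunc k) ^ m ≠ 0 := pow_ne_zero _ hX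
        generalize (RatFunc.X : RatFunc k) ^ m = w at hd hXm ⊢
        have hd' : ((-1 / w) ^ 2 - 1 : RatFunc k) ≠ 0 := by
          intro h
          apply hd
          field_simp at h
          linear_combination -h
        rw [div_eq_div_iff hd' hd]
        field_simp
        ring
    intro g x hx
    obtain ⟨a, b, rfl⟩ := (mem_adjoin_simple_iff k x).1 hx
    rw [map_div₀, ← aeval_algHom_apply, ← aeval_algHom_apply, key]
  · rw [hm.finrank_zero_div_two, DihedralGroup.nat_card]
  · rw [hm.finrank_zero_div_two]
    omega

theorem map_translate_zero_div_two :
    (k⟮algebraMap k[X] (RatFunc k) (X ^ (m + 1)) /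
      algebraMap k[X] (RatFunc k) (X ^ (2 * m + 1) - X)⟯).map (RatFunc.translate 1).toAlgHom =
    k⟮algebraMap k[X] (RatFunc k) ((X - 1) ^ (m + 1)) /
      algebraMap k[X] (RatFunc k) (X ^ (2 * m + 1) - X)⟯ := by
  rw [adjoin_map, Set.image_singleton]
  congr 2
  change RatFunc.translate 1 _ = _
  rw [map_div₀, RatFunc.translate_algebraMap, RatFunc.translate_algebraMap,
    hm.affineParam_two_eq_sub_one, ← hm.affineParam_two_eq_sub_one]
  simp only [X_pow_comp, sub_comp, X_comp, C_1]
  rw [hm.affineParam_two_eq_sub_one]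

theorem isGalois_one_div_two [IsAlgClosed k] :
    IsGalois k⟮algebraMap k[X] (RatFunc k) ((X - 1) ^ (m + 1)) /
      algebraMap k[X] (RatFunc k) (X ^ (2 * m + 1) - X)⟯ (RatFunc k) ∧
    Nonempty ((RatFunc k ≃ₐ[k⟮algebraMap k[X] (RatFunc k) ((X - 1) ^ (m + 1)) /
      algebraMap k[X] (RatFunc k) (X ^ (2 * m + 1) - X)⟯] RatFunc k) ≃* DihedralGroup m) := by
  obtain ⟨h1, ⟨e⟩⟩ := IntermediateField.galois_map_algEquiv (RatFunc.translate (1 : k))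
    hm.map_translate_zero_div_two
  obtain ⟨h2, ⟨f⟩⟩ := hm.isGalois_zero_div_two
  exact ⟨h1.1 h2, ⟨e.symm.trans f⟩⟩

theorem finrank_one_div_two : Module.finrank k⟮algebraMap k[X] (RatFunc k) ((X - 1) ^ (m + 1)) /
      algebraMap k[X] (RatFunc k) (X ^ (2 * m + 1) - X)⟯ (RatFunc k) = 2 * m := by
  have := hm.two_le
  have hd : ((X - 1) ^ (2 * m) - 1 : k[X]).natDegree = 2 * m := by
    have h : ((X - C 1) ^ (2 * m) : k[X]).natDegree = 2 * m := by
      rw [natDegree_pow, natDegree_X_sub_C, mul_one]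
    rw [← C_1, natDegree_sub_eq_left_of_natDegree_lt, h]
    rw [h, natDegree_C]
    omega
  have h1 : ((X - 1) ^ (m + 1) : k[X]) = (X - 1) * (X - 1) ^ m := by ring
  have h2 : (X ^ (2 * m + 1) - X : k[X]) = (X - 1) * ((X - 1) ^ (2 * m) - 1) := by
    rw [hm.affineParam_two_eq_sub_one]; ring
  rw [h1, h2, map_mul, map_mul, mul_div_mul_left _ _ (RatFunc.algebraMap_ne_zero
    (by rw [← C_1]; exact X_sub_C_ne_zero _)), RatFunc.finrank_adjoin_div, hd, ← C_1, natDegree_pow,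
    natDegree_X_sub_C]
  · omega
  · refine ⟨(X - 1) ^ m, -1, ?_⟩
    ring
  · intro h
    rw [h, natDegree_zero] at hd
    omega

/-- The line `Z = 0` and the line `X = (-1) ^ m Y` have no common point on the curve. -/
theorem not_common_root (a : k) (h1 : a ^ (2 * m + 1) - a = 0)
    (h2 : (a - 1) ^ (m + 1) - (-1) ^ m * a ^ (m + 1) = 0) : False := by
  have h2m := hm.two_le
  have h3 : (a - 1) ^ (2 * m + 1) - (a - 1) = 0 := by
    have := congrArg (eval a) hm.affineParam_two_eq_sub_one
    simp only [eval_sub, eval_pow, eval_X, eval_one] at this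
    rw [← this, h1]
  have key : ∀ b : k, b ^ (2 * m + 1) - b = 0 → b * (b ^ m - 1) * (b ^ m + 1) = 0 := by
    intro b hb
    rw [← hb]
    ring
  have hm1 : ((-1 : k) ^ m) ^ 2 = 1 := by rw [← pow_mul, mul_comm, pow_mul]; simp
  have hne : ((-1 : k) ^ m) ≠ 0 := pow_ne_zero _ (by simp)
  by_cases ha : a = 0
  · subst ha
    rw [zero_pow (by omega), mul_zero, sub_zero, zero_sub] at h2
    exact pow_ne_zero _ (by simp) h2
  by_cases ha1 : a - 1 = 0
  · rw [ha1, zero_pow (by omega), zero_sub, neg_eq_zero] at h2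
    exact mul_ne_zero hne (pow_ne_zero _ ha) h2
  -- Both `a` and `a - 1` are nonzero roots of `b (b^m - 1)(b^m + 1)`, so their `m`-th powers are
  -- signs.
  have ha2 : (a ^ m) ^ 2 = 1 := by
    have := (mul_eq_zero.1 (key a h1))
    have h4 : (a ^ m - 1) * (a ^ m + 1) = 0 := by
      have := key a h1
      rw [mul_assoc] at this
      exact (mul_eq_zero.1 this).resolve_left ha
    linear_combination h4
  have ha3 : ((a - 1) ^ m) ^ 2 = 1 := by
    have h4 : ((a - 1) ^ m - 1) * ((a - 1) ^ m + 1) = 0 := by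
      have := key _ h3
      rw [mul_assoc] at this
      exact (mul_eq_zero.1 this).resolve_left ha1
    linear_combination h4
  -- Squaring removes all signs and leaves `a - 1 = -a`. Substituted back, the left side acquires
  -- the sign `(-1)^(m+1)`, opposite to the coefficient `(-1)^m`; this is why that coefficient was
  -- chosen.
  have h5 : (a - 1) ^ 2 = a ^ 2 := by
    have e1 : (a - 1) ^ (m + 1) = (-1) ^ m * a ^ (m + 1) := by linear_combination h2
    have e2 : ((a - 1) ^ m) ^ 2 * (a - 1) ^ 2 = ((-1) ^ m) ^ 2 * ((a ^ m) ^ 2 * a ^ 2) := by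
      calc ((a - 1) ^ m) ^ 2 * (a - 1) ^ 2 = ((a - 1) ^ (m + 1)) ^ 2 := by ring
        _ = _ := by rw [e1]; ring
    rw [ha3, hm1, ha2] at e2
    linear_combination e2
  have h6 : a - 1 = -a := by
    have : (a - 1 - a) * (a - 1 + a) = 0 := by linear_combination h5
    rcases mul_eq_zero.1 this with h | h
    · simp at h
    · linear_combination h
  rw [h6, neg_pow, pow_succ (-1 : k) m] at h2
  have : (2 : k) * ((-1) ^ m * a ^ (m + 1)) = 0 := by linear_combination -h2
  exact mul_ne_zero hm.two_ne_zero (mul_ne_zero hne (pow_ne_zero _ ha)) this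

/-- By `not_common_root` the fraction is already reduced, so the full degree of the denominator
survives. -/
theorem finrank_generic [IsAlgClosed k] : Module.finrank
    k⟮algebraMap k[X] (RatFunc k) ((X - 1) ^ (m + 1) - C ((-1) ^ m) * X ^ (m + 1)) /
      algebraMap k[X] (RatFunc k) (X ^ (2 * m + 1) - X)⟯ (RatFunc k) = 2 * m + 1 := by
  have h := natDegree_sub_one_pow_sub_le (m := m) ((-1 : k) ^ m)
  rw [RatFunc.finrank_adjoin_div _ hm.affineParam_two_ne_zero, hm.natDegree_affineParam_two]
  · omega
  · rw [Polynomial.isCoprime_iff_aeval_ne_zero_of_isAlgClosed k k]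
    intro a
    by_contra! hcon
    apply hm.not_common_root a
    · simpa using hcon.2
    · simpa using hcon.1

/-- The degree of `k(X)` over `L` divides that over each simple subfield of `L`, hence divides both
`2m` and `2m + 1`. -/
theorem adjoin_eq_top [IsAlgClosed k] {L : IntermediateField k (RatFunc k)}
    (h0 : algebraMap k[X] (RatFunc k) (X ^ (m + 1)) /
      algebraMap k[X] (RatFunc k) (X ^ (2 * m + 1) - X) ∈ L)
    (h1 : algebraMap k[X] (RatFunc k) ((X - 1) ^ (m + 1)) /
      algebraMap k[X] (RatFunc k) (X ^ (2 * m + 1) - X) ∈ L) : L = ⊤ := by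
  have key : ∀ h ∈ L, Module.finrank L (RatFunc k) ∣ Module.finrank k⟮h⟯ (RatFunc k) := by
    intro h hh
    exact IntermediateField.finrank_dvd_of_le_left (adjoin_simple_le_iff.2 hh)
  have d1 := key _ h0
  have d2 := key _ (L.sub_mem h1 (L.mul_mem (L.algebraMap_mem ((-1) ^ m)) h0))
  rw [hm.finrank_zero_div_two] at d1
  have e : algebraMap k[X] (RatFunc k) ((X - 1) ^ (m + 1)) /
      algebraMap k[X] (RatFunc k) (X ^ (2 * m + 1) - X) - algebraMap k (RatFunc k) ((-1) ^ m) *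
      (algebraMap k[X] (RatFunc k) (X ^ (m + 1)) /
      algebraMap k[X] (RatFunc k) (X ^ (2 * m + 1) - X)) =
      algebraMap k[X] (RatFunc k) ((X - 1) ^ (m + 1) - C ((-1) ^ m) * X ^ (m + 1)) /
      algebraMap k[X] (RatFunc k) (X ^ (2 * m + 1) - X) := by
    rw [map_sub _ ((X - 1) ^ (m + 1)), map_mul, RatFunc.algebraMap_C, RatFunc.algebraMap_eq_C]
    ring
  rw [e, hm.finrank_generic] at d2
  have d3 : Module.finrank L (RatFunc k) ∣ 1 := by
    simpa using Nat.dvd_sub d2 d1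
  exact IntermediateField.finrank_eq_one_iff_eq_top.1 (Nat.dvd_one.1 d3)

end IsFrobeniusIndex

end AffineParametrization

/-! ### Homogeneous relations between three polynomials, and degrees of projections. -/

section HomogeneousPolynomials

open MvPolynomial

variable {k : Type*} [Field k]

theorem MvPolynomial.IsHomogeneous.aeval_mul_left {σ R A : Type*} [CommSemiring R] [CommSemiring A]
    [Algebra R A] {H : MvPolynomial σ R} {d : ℕ} (hH : H.IsHomogeneous d) (c : A) (v : σ → A) :
    MvPolynomial.aeval (fun i => c * v i) H = c ^ d * MvPolynomial.aeval v H := by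
  simp only [aeval_def, eval₂_eq]
  rw [Finset.mul_sum]
  refine Finset.sum_congr rfl fun e he => ?_
  have h1 : e.degree = d := by
    by_contra h
    exact (mem_support_iff.1 he) (hH.coeff_eq_zero h)
  simp only [mul_pow]
  rw [Finset.prod_mul_distrib, Finset.prod_pow_eq_pow_sum, ← h1, Finsupp.degree_apply]
  ring

theorem MvPolynomial.IsHomogeneous.eval_smul {σ R : Type*} [CommSemiring R]
    {H : MvPolynomial σ R} {d : ℕ} (hH : H.IsHomogeneous d) (c : R) (v : σ → R) :
    eval (c • v) H = c ^ d * eval v H := by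
  have := hH.aeval_mul_left c v
  exact (by simpa [aeval_eq_eval] using this :
    eval (fun i => c * v i) H = c ^ d * eval v H)

/-- A homogeneous polynomial of degree `d`, evaluated at the `i`-th coordinate point. -/
theorem MvPolynomial.IsHomogeneous.eval_single {σ R : Type*} [CommSemiring R] [DecidableEq σ]
    {H : MvPolynomial σ R} {d : ℕ} (hH : H.IsHomogeneous d) (i : σ) :
    eval (Pi.single i 1) H = coeff (Finsupp.single i d) H := by
  rw [eval_eq]
  have key : ∀ e ∈ H.support, e ≠ Finsupp.single i d →
      coeff e H * ∏ j ∈ e.support, (Pi.single i 1 : σ → R) j ^ e j = 0 := by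
    intro e he hne
    have h1 : e.degree = d := by
      by_contra h
      exact (mem_support_iff.1 he) (hH.coeff_eq_zero h)
    have : ∃ j ∈ e.support, j ≠ i := by
      by_contra! hcon
      apply hne
      have hs : e = Finsupp.single i (e i) := by
        ext j
        by_cases hj : j = i
        · subst hj; simp
        · rw [Finsupp.single_apply, if_neg (Ne.symm hj)]
          by_contra h0
          exact hj (hcon j (Finsupp.mem_support_iff.2 h0))
      rw [hs, Finsupp.degree_single] at h1
      rw [hs, h1]
    obtain ⟨j, hj, hji⟩ := this
    rw [Finset.prod_eq_zero hj, mul_zero]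
    rw [Pi.single_eq_of_ne hji, zero_pow (Finsupp.mem_support_iff.1 hj)]
  rw [Finset.sum_eq_single (Finsupp.single i d) key]
  · by_cases hd : d = 0
    · subst hd; simp
    · rw [Finsupp.support_single i hd]
      simp
  · intro h
    rw [notMem_support_iff.1 h, zero_mul]

theorem MvPolynomial.degreeOf_le_of_dvd {σ R : Type*} [CommRing R] [IsDomain R]
    {G H : MvPolynomial σ R} (hH : H ≠ 0) (h : G ∣ H) (i : σ) : G.degreeOf i ≤ H.degreeOf i := by
  obtain ⟨Q, rfl⟩ := h
  rw [degreeOf_mul_eq (left_ne_zero_of_mul hH) (right_ne_zero_of_mul hH)]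
  omega

/-- Three polynomials, of which the last two have a common factor with cofactors of degree at most
`D`, satisfy a homogeneous relation of degree at most `D` in the first variable. -/
theorem exists_homogeneous_relation (a : Fin 3 → Polynomial k) {i₀ i₁ i₂ : Fin 3} (h01 : i₀ ≠ i₁)
    (h02 : i₀ ≠ i₂) (h12 : i₁ ≠ i₂) {D : ℕ} {c b₁ b₂ : Polynomial k}
    (h₁ : a i₁ = c * b₁) (h₂ : a i₂ = c * b₂) (hb₁ : b₁.natDegree ≤ D) (hb₂ : b₂.natDegree ≤ D) :
    ∃ H : MvPolynomial (Fin 3) k, H ≠ 0 ∧ (∃ d, H.IsHomogeneous d) ∧ H.degreeOf i₀ ≤ D ∧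
      aeval a H = 0 := by
  classical
  set r := (a i₀).natDegree with hr
  set s := c.natDegree with hs
  -- There are `(D+1)(M+1)` monomials of degree `d = M + D` with exponents at most `D` and `M` in
  -- the variables `i₀` and `i₁`. Their values all contain the factor `c^M`, and the cofactors `w`
  -- have degree at most `N`. This `M` makes the number of monomials exceed `N + 1`, which forces a
  -- linear dependence.
  set M := D * r + D * s + D * D + 1 with hM
  set d := M + D with hd
  set N := D * r + D * s + d * D with hN
  let ι := Fin (D + 1) × Fin (M + 1)
  let w : ι → Polynomial k := fun x =>
    a i₀ ^ (x.1 : ℕ) * c ^ (D - x.1 : ℕ) * (b₁ ^ (x.2 : ℕ) * b₂ ^ (d - x.1 - x.2 : ℕ))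
  have hlt : ∀ x : ι, (x.1 : ℕ) ≤ D ∧ (x.2 : ℕ) ≤ M := fun x =>
    ⟨Nat.lt_succ_iff.1 x.1.2, Nat.lt_succ_iff.1 x.2.2⟩
  have hwdeg : ∀ x, (w x).natDegree ≤ N := by
    intro x
    have hx := hlt x
    have e1 : (a i₀ ^ (x.1 : ℕ)).natDegree ≤ D * r :=
      Polynomial.natDegree_pow_le.trans (Nat.mul_le_mul_right _ hx.1)
    have e2 : (c ^ (D - x.1 : ℕ)).natDegree ≤ D * s :=
      Polynomial.natDegree_pow_le.trans (Nat.mul_le_mul_right _ (Nat.sub_le _ _))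
    have e3 : (b₁ ^ (x.2 : ℕ) * b₂ ^ (d - x.1 - x.2 : ℕ)).natDegree ≤ d * D := by
      refine Polynomial.natDegree_mul_le.trans ?_
      refine (add_le_add (Polynomial.natDegree_pow_le.trans (Nat.mul_le_mul_left _ hb₁))
        (Polynomial.natDegree_pow_le.trans (Nat.mul_le_mul_left _ hb₂))).trans ?_
      rw [← add_mul]
      exact Nat.mul_le_mul_right _ (by omega)
    refine Polynomial.natDegree_mul_le.trans (add_le_add ?_ e3)
    exact Polynomial.natDegree_mul_le.trans (add_le_add e1 e2)
  have hdep : ¬ LinearIndependent k (fun x : ι => fun n : Fin (N + 1) => (w x).coeff n) := by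
    intro hli
    have := hli.fintype_card_le_finrank
    simp only [ι, Fintype.card_prod, Fintype.card_fin, Module.finrank_fin_fun] at this
    have h3 : (D + 1) * (M + 1) = D * M + D + M + 1 := by ring
    have h4 : N + 1 = D * r + D * s + D * M + D * D + 1 := by rw [hN, hd]; ring
    rw [h3, h4] at this
    omega
  obtain ⟨g, hg, x₀, hx₀⟩ := Fintype.not_linearIndependent_iff.1 hdep
  have hsum : ∑ x, Polynomial.C (g x) * w x = 0 := by
    ext n
    rw [Polynomial.finsetSum_coeff, Polynomial.coeff_zero]
    simp only [Polynomial.coeff_C_mul]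
    by_cases hn : n < N + 1
    · have := congrFun hg ⟨n, hn⟩
      simpa using this
    · apply Finset.sum_eq_zero
      intro x _
      rw [Polynomial.coeff_eq_zero_of_natDegree_lt ((hwdeg x).trans_lt (by omega)), mul_zero]
  let e : ι → (Fin 3 →₀ ℕ) := fun x => Finsupp.single i₀ (x.1 : ℕ) + Finsupp.single i₁ (x.2 : ℕ) +
    Finsupp.single i₂ (d - x.1 - x.2 : ℕ)
  have e0 : ∀ x, e x i₀ = x.1 := by
    intro x
    simp [e, h01.symm, h02.symm]
  have e1 : ∀ x, e x i₁ = x.2 := by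
    intro x
    simp [e, h01, h12.symm]
  have einj : Function.Injective e := by
    intro x y hxy
    ext
    · rw [← e0, ← e0, hxy]
    · rw [← e1, ← e1, hxy]
  refine ⟨∑ x, monomial (e x) (g x), ?_, ⟨d, ?_⟩, ?_, ?_⟩
  · intro h
    have := congrArg (coeff (e x₀)) h
    rw [coeff_sum, Finset.sum_eq_single x₀] at this
    · rw [coeff_monomial, if_pos rfl, coeff_zero] at this
      exact hx₀ this
    · intro y _ hy
      rw [coeff_monomial, if_neg (fun h => hy (einj h))]
    · simp
  · apply IsHomogeneous.sum
    intro x _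
    apply isHomogeneous_monomial
    have := hlt x
    simp only [e, map_add, Finsupp.degree_single]
    omega
  · refine (degreeOf_sum_le _ _ _).trans (Finset.sup_le fun x _ => ?_)
    by_cases hgx : g x = 0
    · simp [hgx]
    · rw [degreeOf_monomial_eq _ _ hgx, e0]
      exact (hlt x).1
  · rw [map_sum]
    have : ∀ x, aeval a (monomial (e x) (g x)) = c ^ M * (Polynomial.C (g x) * w x) := by
      intro x
      have hx := hlt x
      rw [aeval_monomial, Polynomial.algebraMap_eq]
      simp only [e, w]
      rw [Finsupp.prod_add_index' (by simp) (by intros; ring), Finsupp.prod_add_index' (by simp)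
        (by intros; ring), Finsupp.prod_single_index (by simp), Finsupp.prod_single_index (by simp),
        Finsupp.prod_single_index (by simp), h₁, h₂, mul_pow, mul_pow]
      have : c ^ M * c ^ (D - x.1 : ℕ) = c ^ (x.2 : ℕ) * c ^ (d - x.1 - x.2 : ℕ) := by
        rw [← pow_add, ← pow_add]
        congr 1
        omega
      linear_combination -(Polynomial.C (g x) * a i₀ ^ (x.1 : ℕ) * b₁ ^ (x.2 : ℕ) *
        b₂ ^ (d - x.1 - x.2 : ℕ)) * this
    simp only [this]
    rw [← Finset.mul_sum, hsum, mul_zero]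

theorem fin_three_eq_or : ∀ {i₀ i₁ i₂ : Fin 3}, i₀ ≠ i₁ → i₀ ≠ i₂ → i₁ ≠ i₂ →
    ∀ i : Fin 3, i = i₀ ∨ i = i₁ ∨ i = i₂ := by
  decide

/-- A homogeneous relation between three polynomials bounds the degree of the field generated by
their quotients over the field generated by one of these quotients. -/
theorem finrank_adjoin_le_degreeOf [Infinite k] (a : Fin 3 → Polynomial k) {i₀ i₁ i₂ : Fin 3}
    (h01 : i₀ ≠ i₁) (h02 : i₀ ≠ i₂) (h12 : i₁ ≠ i₂) (h0 : a i₂ ≠ 0)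
    {h w : RatFunc k} (hh : h = algebraMap _ (RatFunc k) (a i₁) / algebraMap _ (RatFunc k) (a i₂))
    (hw : w = algebraMap _ (RatFunc k) (a i₀) / algebraMap _ (RatFunc k) (a i₂))
    (htop : ∀ L : IntermediateField k (RatFunc k), h ∈ L → w ∈ L → L = ⊤)
    (htr : Transcendental k h) {G : MvPolynomial (Fin 3) k} (hG0 : G ≠ 0) {n : ℕ}
    (hG : G.IsHomogeneous n) (hGa : aeval a G = 0) :
    Module.finrank (IntermediateField.adjoin k {h}) (RatFunc k) ≤ G.degreeOf i₀ := by
  classical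
  set F := IntermediateField.adjoin k {h} with hF
  let h' : F := ⟨h, IntermediateField.mem_adjoin_simple_self k h⟩
  have hall : ∀ i : Fin 3, i = i₀ ∨ i = i₁ ∨ i = i₂ :=
    fin_three_eq_or h01 h02 h12
  -- Dehomogenize: put `1` for the variable `i₂` and `h` for `i₁`. This leaves a polynomial over
  -- `k(h)` in the variable `i₀`, with `w` as a root.
  let f : Fin 3 → Polynomial F := fun i =>
    if i = i₀ then Polynomial.X else if i = i₁ then Polynomial.C h' else 1
  have f0 : f i₀ = Polynomial.X := by simp [f]
  have f1 : f i₁ = Polynomial.C h' := by simp [f, h01.symm]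
  have f2 : f i₂ = 1 := by simp [f, h02.symm, h12.symm]
  set p : Polynomial F := aeval f G with hp
  have haev : ∀ u : RatFunc k, Polynomial.aeval u p =
      aeval (fun i => if i = i₀ then u else if i = i₁ then h else 1) G := by
    intro u
    have : ((Polynomial.aeval u : Polynomial F →ₐ[F] RatFunc k).restrictScalars k).comp
        (aeval f : MvPolynomial (Fin 3) k →ₐ[k] Polynomial F) =
        aeval (fun i => if i = i₀ then u else if i = i₁ then h else 1) := by
      apply MvPolynomial.algHom_ext
      intro i
      rw [AlgHom.comp_apply, aeval_X, aeval_X, AlgHom.restrictScalars_apply]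
      rcases hall i with rfl | rfl | rfl
      · simp [f0]
      · simp [f1, h01.symm, h']
      · simp [f2, h02.symm, h12.symm]
    exact DFunLike.congr_fun this G
  have hdeg : p.natDegree ≤ G.degreeOf i₀ := by
    rw [hp, aeval_def, eval₂_eq]
    apply Polynomial.natDegree_sum_le_of_forall_le
    intro e he
    refine Polynomial.natDegree_mul_le.trans ?_
    have c1 : (algebraMap k (Polynomial F) (coeff e G)).natDegree = 0 := by
      rw [IsScalarTower.algebraMap_apply k F (Polynomial F)]
      exact Polynomial.natDegree_C _
    rw [c1, zero_add]
    refine (Polynomial.natDegree_prod_le _ _).trans ?_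
    refine le_trans ?_ (monomial_le_degreeOf i₀ he)
    calc ∑ i ∈ e.support, (f i ^ e i).natDegree ≤ ∑ i ∈ e.support, if i = i₀ then e i₀ else 0 := by
          refine Finset.sum_le_sum fun i _ => ?_
          rcases hall i with rfl | rfl | rfl
          · simp [f0]
          · rw [f1, ← Polynomial.C_pow, Polynomial.natDegree_C]; exact Nat.zero_le _
          · rw [f2]; simp
      _ ≤ e i₀ := by
          rw [Finset.sum_ite_eq']
          split_ifs <;> omega
  -- If `p = 0`, transcendence of `h` turns the relation into an identity, so `G` vanishes at every
  -- point whose `i₂` coordinate is `1`. By homogeneity `X i₂ * G` then vanishes everywhere, and `k`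
  -- is infinite.
  have hp0 : p ≠ 0 := by
    intro hzero
    have h1 : ∀ c : k, aeval (fun i => if i = i₀ then Polynomial.C c else if i = i₁ then
        Polynomial.X else 1 : Fin 3 → Polynomial k) G = 0 := by
      intro c
      apply transcendental_iff_injective.1 htr
      rw [map_zero]
      have h2 := haev (algebraMap k _ c)
      rw [hzero, map_zero] at h2
      rw [h2]
      have : (Polynomial.aeval h).comp (aeval (fun i => if i = i₀ then Polynomial.C c else
          if i = i₁ then Polynomial.X else 1 : Fin 3 → Polynomial k)) =
          aeval (fun i => if i = i₀ then algebraMap k _ c else if i = i₁ then h else 1) := by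
        apply MvPolynomial.algHom_ext
        intro i
        rw [AlgHom.comp_apply, aeval_X, aeval_X]
        split_ifs <;> simp
      exact DFunLike.congr_fun this G
    have h2 : ∀ v : Fin 3 → k, v i₂ = 1 → eval v G = 0 := by
      intro v hv
      have h3 := congrArg (Polynomial.aeval (v i₁)) (h1 (v i₀))
      have : (Polynomial.aeval (v i₁)).comp (aeval (fun i => if i = i₀ then Polynomial.C (v i₀) else
          if i = i₁ then Polynomial.X else 1 : Fin 3 → Polynomial k)) = aeval v := by
        apply MvPolynomial.algHom_ext
        intro i
        rw [AlgHom.comp_apply, aeval_X, aeval_X]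
        rcases hall i with rfl | rfl | rfl
        · simp
        · simp [h01.symm]
        · simp [h02.symm, h12.symm, hv]
      have h4 := DFunLike.congr_fun this G
      rw [AlgHom.comp_apply, h3, map_zero, aeval_eq_eval] at h4
      exact h4.symm
    have h3 : X i₂ * G = 0 := by
      apply MvPolynomial.funext
      intro v
      rw [map_mul, eval_X, map_zero]
      by_cases hv : v i₂ = 0
      · rw [hv, zero_mul]
      · have : v = v i₂ • ((v i₂)⁻¹ • v) := by rw [smul_smul, mul_inv_cancel₀ hv, one_smul]
        rw [this, hG.eval_smul, h2 ((v i₂)⁻¹ • v) (by simp [hv])]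
        ring
    exact hG0 ((mul_eq_zero.1 h3).resolve_left (X_ne_zero _))
  have hroot : Polynomial.aeval w p = 0 := by
    rw [haev]
    have hne := RatFunc.algebraMap_ne_zero h0
    have h2 := hG.aeval_mul_left (algebraMap _ (RatFunc k) (a i₂))
      (fun i => if i = i₀ then w else if i = i₁ then h else 1)
    have h3 : (fun i => algebraMap _ (RatFunc k) (a i₂) *
        (if i = i₀ then w else if i = i₁ then h else 1)) =
        fun i => algebraMap _ (RatFunc k) (a i) := by
      funext i
      rcases hall i with rfl | rfl | rfl
      · rw [if_pos rfl, hw, mul_div_cancel₀ _ hne]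
      · rw [if_neg h01.symm, if_pos rfl, hh, mul_div_cancel₀ _ hne]
      · rw [if_neg h02.symm, if_neg h12.symm, mul_one]
    have h4 : aeval (fun i => algebraMap _ (RatFunc k) (a i)) G =
        algebraMap _ (RatFunc k) (aeval a G) := by
      rw [← aeval_algebraMap_apply]
      rfl
    rw [h3, h4, hGa, map_zero] at h2
    exact (mul_eq_zero.1 h2.symm).resolve_left (pow_ne_zero _ hne)
  have hint : IsIntegral F w := isAlgebraic_iff_isIntegral.1 ⟨p, hp0, hroot⟩
  -- As `h` and `w` generate `k(X)`, its degree over `k(h)` is that of the minimal polynomial of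
  -- `w`, which divides `p`.
  have htop' : IntermediateField.adjoin F {w} = ⊤ := by
    rw [← IntermediateField.restrictScalars_eq_top_iff (K := k)]
    apply htop
    · exact (IntermediateField.adjoin F {w}).algebraMap_mem h'
    · exact IntermediateField.mem_adjoin_simple_self F w
  have h1 := IntermediateField.adjoin.finrank hint
  rw [htop', IntermediateField.finrank_top'] at h1
  rw [h1]
  exact (Polynomial.natDegree_le_of_dvd (minpoly.dvd F w hroot) hp0).trans hdeg

end HomogeneousPolynomials

/-! ### The kernel and the image of the substitution of binary forms. -/

section Equation

open MvPolynomial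

variable (k : Type*) [Field k] (m : ℕ)

/-- The binary forms defining `φ₂`, for `q = 2m + 1`. -/
noncomputable def formParam : Fin 3 → MvPolynomial (Fin 2) k :=
  ![X 0 ^ (m + 1) * X 1 ^ m, (X 0 - X 1) ^ (m + 1) * X 1 ^ m,
    X 0 ^ (2 * m + 1) - X 0 * X 1 ^ (2 * m)]

/-- The substitution of the binary forms defining `φ₂`. -/
noncomputable def paramHom : MvPolynomial (Fin 3) k →ₐ[k] MvPolynomial (Fin 2) k :=
  aeval (formParam k m)

variable {k m}

theorem formParam_isHomogeneous (i : Fin 3) : (formParam k m i).IsHomogeneous (2 * m + 1) := by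
  have h0 : (X 0 : MvPolynomial (Fin 2) k).IsHomogeneous 1 := isHomogeneous_X _ _
  have h1 : (X 1 : MvPolynomial (Fin 2) k).IsHomogeneous 1 := isHomogeneous_X _ _
  fin_cases i
  · have := (h0.pow (m + 1)).mul (h1.pow m)
    rwa [show 1 * (m + 1) + 1 * m = 2 * m + 1 by ring] at this
  · have := ((h0.sub h1).pow (m + 1)).mul (h1.pow m)
    rwa [show 1 * (m + 1) + 1 * m = 2 * m + 1 by ring] at this
  · refine IsHomogeneous.sub ?_ ?_
    · simpa using h0.pow (2 * m + 1)
    · have := h0.mul (h1.pow (2 * m))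
      rwa [show 1 + 1 * (2 * m) = 2 * m + 1 by ring] at this

theorem paramHom_isHomogeneous {H : MvPolynomial (Fin 3) k} {d : ℕ} (hH : H.IsHomogeneous d) :
    (paramHom k m H).IsHomogeneous ((2 * m + 1) * d) :=
  hH.aeval _ formParam_isHomogeneous

theorem eval_formParam (v : Fin 2 → k) (i : Fin 3) :
    eval v (formParam k m i) = phi2Vec (2 * m + 1) v i := by
  have h1 : (2 * m + 1 + 1) / 2 = m + 1 := by omega
  fin_cases i <;> simp [formParam, phi2Vec, h1]

theorem eval_paramHom (v : Fin 2 → k) (H : MvPolynomial (Fin 3) k) :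
    eval v (paramHom k m H) = eval (phi2Vec (2 * m + 1) v) H := by
  rw [paramHom, ← aeval_eq_eval, ← aeval_eq_eval]
  have : (aeval v).comp (aeval (formParam k m)) = aeval (phi2Vec (2 * m + 1) v) := by
    apply MvPolynomial.algHom_ext
    intro i
    rw [AlgHom.comp_apply, aeval_X, aeval_X, ← eval_formParam, aeval_eq_eval]
  exact DFunLike.congr_fun this H

theorem eval_affineParam (s : k) (i : Fin 3) :
    (affineParam k m i).eval s = phi2Vec (2 * m + 1) ![s, 1] i := by
  have h1 : (2 * m + 1 + 1) / 2 = m + 1 := by omega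
  fin_cases i <;> simp [affineParam, phi2Vec, h1]

theorem eval_aeval_affineParam (s : k) (H : MvPolynomial (Fin 3) k) :
    (aeval (affineParam k m) H).eval s = eval (phi2Vec (2 * m + 1) ![s, 1]) H := by
  rw [← Polynomial.coe_aeval_eq_eval, ← aeval_eq_eval]
  have : (Polynomial.aeval s).comp (aeval (affineParam k m)) =
      aeval (phi2Vec (2 * m + 1) ![s, 1]) := by
    apply MvPolynomial.algHom_ext
    intro i
    rw [AlgHom.comp_apply, aeval_X, aeval_X, ← eval_affineParam, Polynomial.coe_aeval_eq_eval]
  exact DFunLike.congr_fun this H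

/-- A homogeneous polynomial vanishes on the curve if it vanishes on its affine part. -/
theorem paramHom_eq_zero_iff [Infinite k] {H : MvPolynomial (Fin 3) k} {d : ℕ}
    (hH : H.IsHomogeneous d) : paramHom k m H = 0 ↔ aeval (affineParam k m) H = 0 := by
  constructor
  · intro h
    apply Polynomial.funext
    intro s
    rw [eval_aeval_affineParam, ← eval_paramHom, h]
    simp
  · intro h
    have h3 : X 1 * paramHom k m H = 0 := by
      apply MvPolynomial.funext
      intro v
      rw [map_mul, eval_X, map_zero]
      by_cases hv : v 1 = 0
      · rw [hv, zero_mul]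
      · have : v = v 1 • ![v 0 / v 1, 1] := by
          funext i
          fin_cases i
          · simp [mul_div_cancel₀ _ hv]
          · simp
        rw [this, (paramHom_isHomogeneous hH).eval_smul, eval_paramHom, ← eval_aeval_affineParam, h]
        simp
    exact (mul_eq_zero.1 h3).resolve_left (X_ne_zero _)

/-- Were the inclusion of `(G)` in the kernel strict, then `0 < (G) < ker < ker χ₁ < ker χ₂` would
be a chain of primes of length 4 in a ring of dimension 3. Here `χ₁` restricts to the line `t = 0`
and `χ₂` to the origin. -/
theorem ker_paramHom_eq_span (hm : m ≠ 0) {G : MvPolynomial (Fin 3) k} (hG : Irreducible G)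
    (hGm : paramHom k m G = 0) : RingHom.ker (paramHom k m) = Ideal.span {G} := by
  by_contra hne
  have hGp : (Ideal.span {G}).IsPrime :=
    (Ideal.span_singleton_prime hG.ne_zero).2 hG.prime
  have hle : Ideal.span {G} ≤ RingHom.ker (paramHom k m) := by
    rw [Ideal.span_singleton_le_iff_mem]
    exact hGm
  let χ₁ : MvPolynomial (Fin 3) k →ₐ[k] Polynomial k :=
    (aeval ![Polynomial.X, 0]).comp (paramHom k m)
  let χ₂ : MvPolynomial (Fin 3) k →ₐ[k] k := (Polynomial.aeval 0).comp χ₁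
  have hX : ∀ i, paramHom k m (X i) = formParam k m i := fun i => aeval_X _ _
  have hpow : (X 0 ^ (m + 1) * X 1 ^ m : MvPolynomial (Fin 2) k) ≠ 0 :=
    mul_ne_zero (pow_ne_zero _ (X_ne_zero _)) (pow_ne_zero _ (X_ne_zero _))
  have l1 : RingHom.ker (paramHom k m) < RingHom.ker χ₁ := by
    refine lt_of_le_of_ne ?_ ?_
    · intro x hx
      rw [RingHom.mem_ker] at hx ⊢
      rw [AlgHom.comp_apply, hx, map_zero]
    · intro h
      have h1 : X 0 ∈ RingHom.ker χ₁ := by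
        rw [RingHom.mem_ker, AlgHom.comp_apply, hX]
        simp [formParam, hm]
      rw [← h, RingHom.mem_ker, hX] at h1
      exact hpow h1
  have l2 : RingHom.ker χ₁ < RingHom.ker χ₂ := by
    refine lt_of_le_of_ne ?_ ?_
    · intro x hx
      rw [RingHom.mem_ker] at hx ⊢
      rw [AlgHom.comp_apply, hx, map_zero]
    · intro h
      have h1 : X 2 ∈ RingHom.ker χ₂ := by
        rw [RingHom.mem_ker, AlgHom.comp_apply, AlgHom.comp_apply, hX]
        simp [formParam]
      rw [← h, RingHom.mem_ker, AlgHom.comp_apply, hX] at h1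
      simp [formParam, hm] at h1
  have l0 : (⊥ : Ideal (MvPolynomial (Fin 3) k)) < Ideal.span {G} := by
    rw [bot_lt_iff_ne_bot, Ne, Ideal.span_singleton_eq_bot]
    exact hG.ne_zero
  let s : Fin 5 → PrimeSpectrum (MvPolynomial (Fin 3) k) :=
    ![⟨⊥, Ideal.isPrime_bot⟩, ⟨Ideal.span {G}, hGp⟩, ⟨RingHom.ker (paramHom k m),
      RingHom.ker_isPrime _⟩, ⟨RingHom.ker χ₁, RingHom.ker_isPrime _⟩,
      ⟨RingHom.ker χ₂, RingHom.ker_isPrime _⟩]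
  have hs : StrictMono s := by
    rw [Fin.strictMono_iff_lt_succ]
    intro i
    fin_cases i
    · exact l0
    · exact lt_of_le_of_ne hle (fun h => hne (congrArg PrimeSpectrum.asIdeal h).symm)
    · exact l1
    · exact l2
  have h4 := Order.LTSeries.length_le_krullDim (LTSeries.mk 4 s hs)
  have h3 : Order.krullDim (PrimeSpectrum (MvPolynomial (Fin 3) k)) = 3 := by
    have := MvPolynomial.ringKrullDim_of_isNoetherianRing (R := k) (ι := Fin 3)
    rw [ringKrullDim_eq_zero_of_field] at this
    simpa [ringKrullDim] using this
  rw [h3] at h4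
  have : ((4 : ℕ) : WithBot ℕ∞) ≤ ((3 : ℕ) : WithBot ℕ∞) := h4
  norm_cast at this

/-- The valuative form of the absence of common zeros of the three forms on the projective line. If
the larger of `s`, `t` has value above 1, divide by it: then `r` and `r - 1`, or `r` and `1 -
r^(2m)`, both have value below 1, and so would `1`. -/
theorem Valuation.le_one_of_formParam {K Γ : Type*} [Field K] [LinearOrderedCommGroupWithZero Γ]
    (v : Valuation K Γ) {m : ℕ} (hm : 1 ≤ m) {s t : K} (h0 : v (s ^ (m + 1) * t ^ m) ≤ 1)
    (h1 : v ((s - t) ^ (m + 1) * t ^ m) ≤ 1) (h2 : v (s ^ (2 * m + 1) - s * t ^ (2 * m)) ≤ 1) :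
    v s ≤ 1 ∧ v t ≤ 1 := by
  by_contra hcon
  have small : ∀ {u r : K} {a b : ℕ}, a ≠ 0 → b ≠ 0 → 1 < v u → v (u ^ a * r ^ b) ≤ 1 → v r < 1 := by
    intro u r a b ha hb hu h
    by_contra! hr
    rw [map_mul, map_pow, map_pow] at h
    have h3 : 1 < v u ^ a := one_lt_pow₀ hu ha
    have h4 : 1 ≤ v r ^ b := one_le_pow₀ hr
    exact absurd h (not_le.2 (one_lt_mul_of_lt_of_le' h3 h4))
  rcases le_total (v s) (v t) with hst | hst
  · have ht : 1 < v t := by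
      by_contra! h
      exact hcon ⟨hst.trans h, h⟩
    have ht0 : t ≠ 0 := by
      rintro rfl
      simp at ht
    obtain ⟨r, rfl⟩ : ∃ r, s = t * r := ⟨s / t, (mul_div_cancel₀ s ht0).symm⟩
    have e0 : (t * r) ^ (m + 1) * t ^ m = t ^ (2 * m + 1) * r ^ (m + 1) := by ring
    have e1 : (t * r - t) ^ (m + 1) * t ^ m = t ^ (2 * m + 1) * (r - 1) ^ (m + 1) := by
      rw [show t * r - t = t * (r - 1) by ring, mul_pow]
      ring
    have r0 := small (by omega) (by omega) ht (e0 ▸ h0)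
    have r1 := small (by omega) (by omega) ht (e1 ▸ h1)
    have : v (r - (r - 1)) < 1 := v.map_sub_lt r0 r1
    simp at this
  · have hs : 1 < v s := by
      by_contra! h
      exact hcon ⟨h, hst.trans h⟩
    have hs0 : s ≠ 0 := by
      rintro rfl
      simp at hs
    obtain ⟨r, rfl⟩ : ∃ r, t = s * r := ⟨t / s, (mul_div_cancel₀ t hs0).symm⟩
    have e0 : s ^ (m + 1) * (s * r) ^ m = s ^ (2 * m + 1) * r ^ m := by ring
    have e2 : s ^ (2 * m + 1) - s * (s * r) ^ (2 * m) =
        s ^ (2 * m + 1) * (1 - r ^ (2 * m)) ^ 1 := by ring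
    have r0 := small (by omega) (by omega) hs (e0 ▸ h0)
    have r1 := small (by omega) one_ne_zero hs (e2 ▸ h2)
    have r2 : v (r ^ (2 * m)) < 1 := by
      rw [map_pow]
      exact pow_lt_one₀ zero_le r0 (by omega)
    have : v (1 - r ^ (2 * m) + r ^ (2 * m)) < 1 := v.map_add_lt r1 r2
    simp at this

/-- The integral closure in the fraction field is the intersection of the valuation rings containing
the image, so integrality of the two variables reduces to `Valuation.le_one_of_formParam`. -/
theorem paramHom_isIntegral (hm : 1 ≤ m) : (paramHom k m).toRingHom.IsIntegral := by
  let B := MvPolynomial (Fin 2) k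
  let L := FractionRing B
  let f : MvPolynomial (Fin 3) k →+* L := (algebraMap B L).comp (paramHom k m).toRingHom
  have hX : ∀ i, f (X i) = algebraMap B L (formParam k m i) := fun i =>
    congrArg (algebraMap B L) (aeval_X _ _)
  have hV : ∀ i : Fin 2, algebraMap B L (X i) ∈ (integralClosure (Subring.closure
      (Set.range f)) L).toSubring := by
    intro i
    rw [← iInf_valuationSubring_superset, Subring.mem_iInf]
    rintro ⟨V, hV⟩
    have hx : ∀ i, V.valuation (algebraMap B L (formParam k m i)) ≤ 1 := by
      intro i
      rw [V.valuation_le_one_iff]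
      exact hV ⟨X i, hX i⟩
    have h0 := hx 0
    have h1 := hx 1
    have h2 := hx 2
    simp only [formParam, Matrix.cons_val, map_mul, map_pow, map_sub] at h0 h1 h2
    have := Valuation.le_one_of_formParam V.valuation hm (s := algebraMap B L (X 0))
      (t := algebraMap B L (X 1)) (by simpa using h0) (by simpa using h1) (by simpa using h2)
    change algebraMap B L (X i) ∈ V
    rw [← V.valuation_le_one_iff]
    fin_cases i
    · exact this.1
    · exact this.2
  have hcl : Subring.closure (Set.range f) = f.range := by
    rw [← RingHom.coe_range, Subring.closure_eq]
  have key : ∀ i : Fin 2, (paramHom k m).toRingHom.IsIntegralElem (X i) := by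
    intro i
    obtain ⟨p, hp, hp0⟩ : IsIntegral (Subring.closure (Set.range f)) (algebraMap B L (X i)) := hV i
    let g : MvPolynomial (Fin 3) k →+* Subring.closure (Set.range f) :=
      f.codRestrict _ fun x => Subring.subset_closure ⟨x, rfl⟩
    have hg : Function.Surjective g := by
      rintro ⟨x, hx⟩
      rw [hcl] at hx
      obtain ⟨y, rfl⟩ := hx
      exact ⟨y, rfl⟩
    -- The monic equation has coefficients in the image of the substitution; it is lifted to a monic
    -- equation over the source.
    have hlift : p ∈ Polynomial.lifts g :=
      (Polynomial.lifts_iff_coeff_lifts p).2 fun n => hg _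
    obtain ⟨r, hr, -, hr1⟩ := Polynomial.lifts_and_natDegree_eq_and_monic hlift hp
    refine ⟨r, hr1, ?_⟩
    apply IsFractionRing.injective B L
    rw [Polynomial.hom_eval₂, map_zero, ← hp0, ← hr, Polynomial.eval₂_map]
    rfl
  intro b
  induction b using MvPolynomial.induction_on with
  | C a =>
    have : C a = (paramHom k m).toRingHom (C a) := ((paramHom k m).commutes a).symm
    rw [this]
    exact RingHom.isIntegralElem_map _
  | add p q hp hq => exact RingHom.IsIntegralElem.add _ hp hq
  | mul_X p i hp => exact RingHom.IsIntegralElem.mul _ hp (key i)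

/-- A point is in the image of the parametrization if the equation of the image vanishes on it. -/
theorem exists_phi2Vec_eq [IsAlgClosed k] (hm : 1 ≤ m) {w : Fin 3 → k}
    (hw : ∀ H ∈ RingHom.ker (paramHom k m), eval w H = 0) :
    ∃ v : Fin 2 → k, phi2Vec (2 * m + 1) v = w := by
  algebraize [(paramHom k m).toRingHom]
  have hint : Algebra.IsIntegral (MvPolynomial (Fin 3) k) (MvPolynomial (Fin 2) k) :=
    ⟨paramHom_isIntegral hm⟩
  have hmax : (vanishingIdeal k {w}).IsMaximal := inferInstance
  -- Lying over: the maximal ideal of `w` contains the kernel, so it is the contraction of a maximal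
  -- ideal, and the Nullstellensatz makes the latter the ideal of a point `v`.
  obtain ⟨Q, hQ, hQw⟩ := Ideal.exists_ideal_over_maximal_of_isIntegral
    (S := MvPolynomial (Fin 2) k) (vanishingIdeal k {w}) (by
      intro H hH
      rw [mem_vanishingIdeal_singleton_iff]
      exact hw H hH)
  obtain ⟨v, rfl⟩ := eq_vanishingIdeal_singleton_of_isMaximal k hQ
  refine ⟨v, ?_⟩
  funext i
  have h1 : X i - C (w i) ∈ vanishingIdeal k {w} := by
    rw [mem_vanishingIdeal_singleton_iff]
    simp
  rw [← hQw, Ideal.mem_comap, mem_vanishingIdeal_singleton_iff] at h1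
  have h2 : eval v (paramHom k m (X i - C (w i))) = 0 := h1
  rw [eval_paramHom] at h2
  simpa [sub_eq_zero] using h2

end Equation

/-! ### The image as a plane curve. -/

section Curve

open MvPolynomial

variable {k : Type*} [Field k] {m : ℕ}

theorem phi2_mk (hq : Odd (2 * m + 1)) (v : Fin 2 → k) (hv : v ≠ 0) :
    phi2 hq (Projectivization.mk k v hv) =
      Projectivization.mk k (phi2Vec (2 * m + 1) v) (phi2Vec_ne_zero hq hv) :=
  rfl

theorem MvPolynomial.IsHomogeneous.eval_rep_mk_eq_zero_iff {H : MvPolynomial (Fin 3) k} {d : ℕ}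
    (hH : H.IsHomogeneous d) (v : Fin 3 → k) (hv : v ≠ 0) :
    eval (Projectivization.mk k v hv).rep H = 0 ↔ eval v H = 0 := by
  obtain ⟨c, hc⟩ := Projectivization.exists_smul_eq_mk_rep k v hv
  rw [← hc, Units.smul_def, hH.eval_smul]
  simp

theorem PlaneCurve.mk_mem_points_iff (C : PlaneCurve k) (v : Fin 3 → k) (hv : v ≠ 0) :
    Projectivization.mk k v hv ∈ C.points ↔ eval v C.poly = 0 :=
  C.homogeneous.eval_rep_mk_eq_zero_iff v hv

theorem PlaneCurve.isSmoothPoint_mk_iff (C : PlaneCurve k) (v : Fin 3 → k) (hv : v ≠ 0) :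
    C.IsSmoothPoint (Projectivization.mk k v hv) ↔
      eval v C.poly = 0 ∧ ∃ i, eval v (pderiv i C.poly) ≠ 0 := by
  unfold PlaneCurve.IsSmoothPoint
  rw [C.mk_mem_points_iff]
  refine and_congr Iff.rfl (exists_congr fun i => not_congr ?_)
  exact C.homogeneous.pderiv.eval_rep_mk_eq_zero_iff v hv

/-- The substitution multiplies degrees by `2m + 1`, so it respects the gradings. Its kernel is
therefore a homogeneous ideal. -/
theorem paramHom_homogeneousComponent (H : MvPolynomial (Fin 3) k) (d : ℕ) :
    paramHom k m (homogeneousComponent d H) =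
      homogeneousComponent ((2 * m + 1) * d) (paramHom k m H) := by
  conv_rhs => rw [← sum_homogeneousComponent H]
  rw [map_sum, map_sum]
  have key : ∀ i, homogeneousComponent ((2 * m + 1) * d) (paramHom k m (homogeneousComponent i H)) =
      if i = d then paramHom k m (homogeneousComponent i H) else 0 := by
    intro i
    rw [homogeneousComponent_of_mem (paramHom_isHomogeneous (homogeneousComponent_isHomogeneous i H))]
    by_cases h : i = d
    · rw [if_pos h, if_pos (by rw [h])]
    · rw [if_neg h, if_neg]
      intro h'
      exact h (Nat.eq_of_mul_eq_mul_left (by omega) h').symm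
  simp only [key]
  rw [Finset.sum_ite_eq' (Finset.range (H.totalDegree + 1)) d]
  split_ifs with h
  · rfl
  · rw [homogeneousComponent_eq_zero, map_zero]
    simpa using h

/-- The equation of the image of the parametrization. -/
theorem exists_planeCurve_ker_eq [Infinite k] (hm : m ≠ 0) :
    ∃ C : PlaneCurve k, RingHom.ker (paramHom k m) = Ideal.span {C.poly} := by
  -- Only existence matters here: the common factor is `1` and the degree bound is discarded.
  obtain ⟨H, hH0, ⟨d, hH⟩, -, hHa⟩ := exists_homogeneous_relation (affineParam k m)
    (i₀ := 0) (i₁ := 1) (i₂ := 2) (by decide) (by decide) (by decide)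
    (one_mul (affineParam k m 1)).symm (one_mul (affineParam k m 2)).symm
    (le_max_left _ _) (le_max_right _ _)
  have hHm : H ∈ RingHom.ker (paramHom k m) := (paramHom_eq_zero_iff hH).2 hHa
  have hprime : (RingHom.ker (paramHom k m)).IsPrime := RingHom.ker_isPrime _
  obtain ⟨G, hG, hGp⟩ := hprime.exists_mem_prime_of_ne_bot
    (fun h => hH0 (by rwa [h, Ideal.mem_bot] at hHm))
  have hker := ker_paramHom_eq_span hm hGp.irreducible hG
  -- A nonzero homogeneous component of `G` lies in the kernel, hence is a multiple of `G`;
  -- comparing degrees, the cofactor is a constant.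
  have hhom : G.IsHomogeneous G.totalDegree := by
    obtain ⟨n, hn⟩ : ∃ n, homogeneousComponent n G ≠ 0 := by
      by_contra! hcon
      apply hGp.ne_zero
      rw [← sum_homogeneousComponent G]
      exact Finset.sum_eq_zero fun i _ => hcon i
    have hmem : homogeneousComponent n G ∈ RingHom.ker (paramHom k m) := by
      rw [RingHom.mem_ker, paramHom_homogeneousComponent, hG, map_zero]
    rw [hker, Ideal.mem_span_singleton] at hmem
    obtain ⟨Q, hQ⟩ := hmem
    have hQ0 : Q ≠ 0 := by
      rintro rfl
      exact hn (by rw [hQ, mul_zero])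
    have hdeg := congrArg totalDegree hQ
    rw [totalDegree_mul_of_isDomain hGp.ne_zero hQ0,
      (homogeneousComponent_isHomogeneous n G).totalDegree hn] at hdeg
    have hle : n ≤ G.totalDegree := by
      by_contra! h
      exact hn (homogeneousComponent_eq_zero n G h)
    have hQd : Q.totalDegree = 0 := by omega
    rw [totalDegree_eq_zero_iff_eq_C] at hQd
    have hr : coeff 0 Q ≠ 0 := by
      intro h
      apply hQ0
      rw [hQd, h, C_0]
    have hGQ : G = C (coeff 0 Q)⁻¹ * homogeneousComponent n G := by
      rw [hQ]
      nth_rewrite 2 [hQd]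
      rw [mul_comm G, ← mul_assoc, ← C_mul, inv_mul_cancel₀ hr, C_1, one_mul]
    have hGn : G.IsHomogeneous n := by
      rw [hGQ]
      exact (homogeneousComponent_isHomogeneous n G).C_mul _
    rwa [hGn.totalDegree hGp.ne_zero]
  exact ⟨⟨G, hhom, hGp.irreducible⟩, hker⟩

namespace PlaneCurve

variable {C : PlaneCurve k}

theorem points_eq_of_ker_eq [IsAlgClosed k] (hm : 1 ≤ m) (hq : Odd (2 * m + 1))
    (hker : RingHom.ker (paramHom k m) = Ideal.span {C.poly}) :
    C.points = Set.range (phi2 (k := k) hq) := by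
  ext P
  constructor
  · intro hP
    obtain ⟨v, hv⟩ := exists_phi2Vec_eq (k := k) hm (w := P.rep) (by
      intro H hH
      rw [hker, Ideal.mem_span_singleton] at hH
      obtain ⟨Q, rfl⟩ := hH
      rw [map_mul, show eval P.rep C.poly = 0 from hP, zero_mul])
    have hv0 : v ≠ 0 := by
      rintro rfl
      apply P.rep_nonzero
      rw [← hv]
      funext i
      have : (2 * m + 1 + 1) / 2 ≠ 0 := by omega
      fin_cases i <;> simp [phi2Vec, this]
    refine ⟨Projectivization.mk k v hv0, ?_⟩
    rw [phi2_mk, ← P.mk_rep]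
    congr
  · rintro ⟨u, rfl⟩
    induction u using Projectivization.ind with | h v hv
    rw [phi2_mk, mk_mem_points_iff, ← eval_paramHom]
    have : C.poly ∈ RingHom.ker (paramHom k m) := by
      rw [hker]
      exact Ideal.mem_span_singleton_self _
    rw [RingHom.mem_ker] at this
    rw [this, map_zero]

/-- An equation vanishing on the image lies in the kernel, and irreducibility makes it a generator.
All later statements thus depend on the point set alone. -/
theorem ker_eq_of_points_eq [Infinite k] (hm : m ≠ 0) (hq : Odd (2 * m + 1))
    (hC : C.points = Set.range (phi2 (k := k) hq)) :
    RingHom.ker (paramHom k m) = Ideal.span {C.poly} := by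
  apply ker_paramHom_eq_span hm C.irreducible
  -- The factor `X 0` takes care of the zero vector, which represents no projective point.
  have h3 : X 0 * paramHom k m C.poly = 0 := by
    apply MvPolynomial.funext
    intro v
    rw [map_mul, eval_X, map_zero]
    by_cases hv : v = 0
    · simp [hv]
    · have : phi2 hq (Projectivization.mk k v hv) ∈ C.points := by
        rw [hC]
        exact ⟨_, rfl⟩
      rw [phi2_mk, mk_mem_points_iff, ← eval_paramHom] at this
      rw [this, mul_zero]
  exact (mul_eq_zero.1 h3).resolve_left (X_ne_zero _)

theorem poly_dvd_iff [Infinite k] (hker : RingHom.ker (paramHom k m) = Ideal.span {C.poly})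
    {H : MvPolynomial (Fin 3) k} {d : ℕ} (hH : H.IsHomogeneous d) :
    C.poly ∣ H ↔ aeval (affineParam k m) H = 0 := by
  rw [← Ideal.mem_span_singleton, ← hker, RingHom.mem_ker, paramHom_eq_zero_iff hH]

end PlaneCurve

end Curve

/-! ### Smoothness at a point read off the degree of the equation in one variable. -/

section Shear

open MvPolynomial

variable {k : Type*} [Field k]

theorem Finsupp.eq_single_of_degree_eq {τ : Type*} {e : τ →₀ ℕ} {i : τ} (h : e.degree = e i) :
    e = Finsupp.single i (e i) := by
  have h1 : e.erase i + Finsupp.single i (e i) = e := Finsupp.erase_add_single i e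
  have h2 := congrArg Finsupp.degree h1
  rw [map_add, Finsupp.degree_single, h] at h2
  have h3 : (e.erase i).degree = 0 := by omega
  rw [Finsupp.degree_eq_zero_iff] at h3
  rw [h3, zero_add] at h1
  exact h1.symm

/-- The linear substitution moving the `i`-th coordinate point to the point `v` with `v i = 1`. -/
noncomputable def shear {σ : Type*} [DecidableEq σ] (i : σ) (v : σ → k) :
    MvPolynomial σ k →ₐ[k] MvPolynomial σ k :=
  aeval fun j => if j = i then X i else X j + C (v j) * X i

section

variable {σ : Type*} [DecidableEq σ] (i : σ) (v : σ → k)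

theorem shear_X_self : shear i v (X i) = X i := by
  simp [shear]

theorem shear_X_of_ne {j : σ} (hj : j ≠ i) : shear i v (X j) = X j + C (v j) * X i := by
  simp [shear, hj]

theorem shear_neg_shear (H : MvPolynomial σ k) : shear i v (shear i (-v) H) = H := by
  have : (shear i v).comp (shear i (-v)) = AlgHom.id k _ := by
    apply MvPolynomial.algHom_ext
    intro j
    rw [AlgHom.comp_apply]
    by_cases hj : j = i
    · subst hj
      rw [shear_X_self, shear_X_self]
      rfl
    · rw [shear_X_of_ne _ _ hj, map_add, map_mul, shear_X_of_ne _ _ hj, shear_X_self]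
      have : shear i v (C ((-v) j)) = C ((-v) j) := (shear i v).commutes _
      rw [this]
      simp
  exact DFunLike.congr_fun this H

theorem shear_isHomogeneous {H : MvPolynomial σ k} {d : ℕ} (hH : H.IsHomogeneous d) :
    (shear i v H).IsHomogeneous d := by
  have := hH.aeval (fun j => if j = i then X i else X j + C (v j) * X i) (n := 1) (by
    intro j
    split_ifs
    · exact isHomogeneous_X _ _
    · exact (isHomogeneous_X _ _).add ((isHomogeneous_X _ _).C_mul _))
  rwa [one_mul] at this

variable {i v}

theorem eval_single_shear (hv : v i = 1) (H : MvPolynomial σ k) :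
    eval (Pi.single i 1) (shear i v H) = eval v H := by
  rw [← aeval_eq_eval, ← aeval_eq_eval]
  have : (aeval (Pi.single i 1)).comp (shear i v) = aeval (R := k) v := by
    apply MvPolynomial.algHom_ext
    intro j
    rw [AlgHom.comp_apply]
    by_cases hj : j = i
    · subst hj
      rw [shear_X_self]
      simp [hv]
    · rw [shear_X_of_ne _ _ hj]
      simp [hj]
  exact DFunLike.congr_fun this H

/-- The chain rule for the linear substitution, evaluated at the coordinate point. -/
theorem eval_single_pderiv_shear [Fintype σ] (hv : v i = 1) (j : σ) (H : MvPolynomial σ k) :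
    eval (Pi.single i 1) (pderiv j (shear i v H)) =
      ∑ l, eval v (pderiv l H) * eval (Pi.single i 1) (pderiv j (shear i v (X l))) := by
  induction H using MvPolynomial.induction_on with
  | C a =>
    have : shear i v (C a) = C a := (shear i v).commutes a
    rw [this]
    simp
  | add p q hp hq =>
    simp only [map_add, hp, hq, add_mul, Finset.sum_add_distrib]
  | mul_X p n hp =>
    rw [map_mul, Derivation.leibniz, map_add, smul_eq_mul, smul_eq_mul, map_mul, map_mul, hp,
      eval_single_shear hv, eval_single_shear hv, eval_X]
    simp only [Derivation.leibniz, map_add, smul_eq_mul, map_mul, eval_X, add_mul,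
      Finset.sum_add_distrib]
    congr 1
    · rw [Finset.sum_eq_single n]
      · simp
      · intro l _ hl
        rw [pderiv_X_of_ne hl.symm]
        simp
      · simp
    · rw [Finset.mul_sum]
      exact Finset.sum_congr rfl fun l _ => by ring

/-- The degree in the `i`-th variable of the equation, after a linear substitution moving a smooth
point to the `i`-th coordinate point. -/
theorem le_degreeOf_shear_add_one [Fintype σ] (hv : v i = 1) {G : MvPolynomial σ k} {n : ℕ}
    (hG : G.IsHomogeneous n) (h : ∃ j, eval v (pderiv j G) ≠ 0) :
    n ≤ (shear i v G).degreeOf i + 1 := by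
  by_contra! hlt
  have hz : ∀ j, eval (Pi.single i 1) (pderiv j (shear i v G)) = 0 := by
    intro j
    rw [(shear_isHomogeneous i v hG).pderiv.eval_single, coeff_pderiv]
    -- The `j`-th partial derivative at the coordinate point is a multiple of the coefficient of
    -- `x_i^(n-1) x_j`, excluded when the degree in `x_i` is at most `n - 2`.
    suffices coeff (Finsupp.single i (n - 1) + Finsupp.single j 1) (shear i v G) = 0 by
      rw [this, zero_mul]
    by_contra hne
    have := monomial_le_degreeOf i (mem_support_iff.2 hne)
    simp at this
    omega
  -- The Jacobian of the substitution is triangular: the derivatives with `j ≠ i` vanish first, and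
  -- then the one with `j = i`.
  have hj : ∀ j, j ≠ i → eval v (pderiv j G) = 0 := by
    intro j hj
    have := hz j
    rw [eval_single_pderiv_shear hv, Finset.sum_eq_single j] at this
    · rw [shear_X_of_ne _ _ hj] at this
      simpa [pderiv_X_of_ne hj.symm] using this
    · intro l _ hl
      by_cases hli : l = i
      · subst hli
        rw [shear_X_self, pderiv_X_of_ne hj.symm]
        simp
      · rw [shear_X_of_ne _ _ hli]
        simp [pderiv_X_of_ne hl, pderiv_X_of_ne hj.symm]
    · simp
  obtain ⟨j, hne⟩ := h
  by_cases hji : j = i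
  · subst hji
    have := hz j
    rw [eval_single_pderiv_shear hv, Finset.sum_eq_single j] at this
    · rw [shear_X_self] at this
      exact hne (by simpa using this)
    · intro l _ hl
      rw [hj l hl, zero_mul]
    · simp
  · exact hne (hj j hji)

theorem le_degreeOf_shear (hv : v i = 1) {G : MvPolynomial σ k} {n : ℕ}
    (hG : G.IsHomogeneous n) (h : eval v G ≠ 0) : n ≤ (shear i v G).degreeOf i := by
  rw [← eval_single_shear hv, (shear_isHomogeneous i v hG).eval_single] at h
  have := monomial_le_degreeOf i (mem_support_iff.2 h)
  simpa using this

theorem degreeOf_lt_of_eval_single_eq_zero {G : MvPolynomial σ k} {n : ℕ} (hn : n ≠ 0)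
    (hG : G.IsHomogeneous n) (h : eval (Pi.single i 1) G = 0) : G.degreeOf i < n := by
  rw [degreeOf_lt_iff (by omega)]
  intro e he
  have hd : e.degree = n := by
    by_contra h
    exact (mem_support_iff.1 he) (hG.coeff_eq_zero h)
  refine lt_of_le_of_ne (hd ▸ Finsupp.le_degree i e) ?_
  intro hi
  rw [hG.eval_single] at h
  have := Finsupp.eq_single_of_degree_eq (hd.trans hi.symm)
  rw [this, hi] at he
  exact (mem_support_iff.1 he) h

/-- Some monomial `x_i^(n-1) x_j` with `j ≠ i` occurs, and its coefficient is the `j`-th partial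
derivative at the coordinate point. As `x_j` occurs to the first power, the characteristic does not
interfere. -/
theorem exists_eval_single_pderiv_ne_zero {G : MvPolynomial σ k} {n : ℕ} (hn : 2 ≤ n)
    (hG : G.IsHomogeneous n) (h : eval (Pi.single i 1) G = 0) (hdeg : n ≤ G.degreeOf i + 1) :
    ∃ j, eval (Pi.single i 1) (pderiv j G) ≠ 0 := by
  have hlt := degreeOf_lt_of_eval_single_eq_zero (by omega) hG h
  have h1 : ¬ G.degreeOf i < n - 1 := by omega
  rw [degreeOf_lt_iff (by omega)] at h1
  push Not at h1
  obtain ⟨e, he, hei⟩ := h1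
  have hd : e.degree = n := by
    by_contra h
    exact (mem_support_iff.1 he) (hG.coeff_eq_zero h)
  have hei' : e i = n - 1 := by
    have := monomial_le_degreeOf i he
    omega
  have h1 : e.erase i + Finsupp.single i (e i) = e := Finsupp.erase_add_single i e
  have h2 := congrArg Finsupp.degree h1
  rw [map_add, Finsupp.degree_single, hd, hei'] at h2
  have h3 : (e.erase i).degree = 1 := by omega
  obtain ⟨j, hj⟩ : ∃ j, e.erase i = Finsupp.single j 1 := by
    obtain ⟨j, hj⟩ : ∃ j, e.erase i j ≠ 0 := by
      by_contra! hcon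
      have : e.erase i = 0 := Finsupp.ext hcon
      rw [this] at h3
      simp at h3
    have hle := Finsupp.le_degree j (e.erase i)
    have hj1 : e.erase i j = 1 := by omega
    refine ⟨j, ?_⟩
    rw [← hj1]
    exact Finsupp.eq_single_of_degree_eq (h3.trans hj1.symm)
  have hji : j ≠ i := by
    rintro rfl
    have := DFunLike.congr_fun hj j
    simp at this
  refine ⟨j, ?_⟩
  rw [hG.pderiv.eval_single, coeff_pderiv]
  rw [hj, hei', add_comm] at h1
  rw [h1]
  simpa [Finsupp.single_apply, hji.symm] using he

end

end Shear

/-! ### The degree of the curve, and its smooth and singular points. -/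

section SmoothPoints

open MvPolynomial

variable {k : Type*} [Field k] {m : ℕ} {C : PlaneCurve k}

theorem RatFunc.transcendental_of_finrank_pos {f : RatFunc k}
    (h : 0 < Module.finrank (IntermediateField.adjoin k {f}) (RatFunc k)) :
    Transcendental k f := by
  apply RatFunc.transcendental_of_ne_C
  rw [RatFunc.finrank_eq_max_natDegree] at h
  rintro ⟨c, rfl⟩
  simp at h

namespace PlaneCurve

theorem aeval_affineParam_poly [Infinite k]
    (hker : RingHom.ker (paramHom k m) = Ideal.span {C.poly}) :
    aeval (affineParam k m) C.poly = 0 :=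
  (poly_dvd_iff hker C.homogeneous).1 dvd_rfl

theorem eval_phi2Vec_poly [Infinite k]
    (hker : RingHom.ker (paramHom k m) = Ideal.span {C.poly}) (s : k) :
    eval (phi2Vec (2 * m + 1) ![s, 1]) C.poly = 0 := by
  rw [← eval_aeval_affineParam, aeval_affineParam_poly hker, Polynomial.eval_zero]

theorem eval_single_one_poly [Infinite k]
    (hker : RingHom.ker (paramHom k m) = Ideal.span {C.poly}) :
    eval (Pi.single 1 1) C.poly = 0 := by
  have h1 : (2 * m + 1 + 1) / 2 = m + 1 := by omega
  have h := eval_phi2Vec_poly hker 0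
  have hv : phi2Vec (2 * m + 1) ![(0 : k), 1] = (-1 : k) ^ (m + 1) • Pi.single 1 1 := by
    funext i
    fin_cases i <;> simp [phi2Vec, h1]
  rw [hv, C.homogeneous.eval_smul] at h
  exact (mul_eq_zero.1 h).resolve_left (pow_ne_zero _ (pow_ne_zero _ (by simp)))

theorem eval_single_zero_poly [Infinite k]
    (hker : RingHom.ker (paramHom k m) = Ideal.span {C.poly}) :
    eval (Pi.single 0 1) C.poly = 0 := by
  have h1 : (2 * m + 1 + 1) / 2 = m + 1 := by omega
  have h := eval_phi2Vec_poly hker 1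
  have hv : phi2Vec (2 * m + 1) ![(1 : k), 1] = Pi.single 0 1 := by
    funext i
    fin_cases i <;> simp [phi2Vec, h1]
  rwa [hv] at h

/-- If the linear forms vanishing at `v` have a common factor on the parametrizing line, with
cofactors of degree at most `D`, then the multiplicity of `v` is at least `deg C - D`. -/
theorem degreeOf_shear_poly_le [Infinite k]
    (hker : RingHom.ker (paramHom k m) = Ideal.span {C.poly}) {i₀ i₁ i₂ : Fin 3} (h01 : i₀ ≠ i₁)
    (h02 : i₀ ≠ i₂) (h12 : i₁ ≠ i₂) (v : Fin 3 → k) {D : ℕ} {c b₁ b₂ : Polynomial k}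
    (h₁ : affineParam k m i₁ - Polynomial.C (v i₁) * affineParam k m i₀ = c * b₁)
    (h₂ : affineParam k m i₂ - Polynomial.C (v i₂) * affineParam k m i₀ = c * b₂)
    (hb₁ : b₁.natDegree ≤ D) (hb₂ : b₂.natDegree ≤ D) :
    (shear i₀ v C.poly).degreeOf i₀ ≤ D := by
  -- The parametrization in coordinates that put `v` at the `i₀`-th coordinate point; a relation for
  -- it yields a multiple of the sheared equation.
  let a : Fin 3 → Polynomial k := fun j => if j = i₀ then affineParam k m i₀ else
    affineParam k m j - Polynomial.C (v j) * affineParam k m i₀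
  have ha₁ : a i₁ = c * b₁ := by simp only [a, if_neg h01.symm, h₁]
  have ha₂ : a i₂ = c * b₂ := by simp only [a, if_neg h02.symm, h₂]
  obtain ⟨H, hH0, ⟨d, hH⟩, hHD, hHa⟩ := exists_homogeneous_relation a h01 h02 h12 ha₁ ha₂ hb₁ hb₂
  have hcomp : (aeval (affineParam k m)).comp (shear i₀ (-v)) = aeval a := by
    apply MvPolynomial.algHom_ext
    intro j
    rw [AlgHom.comp_apply]
    by_cases hj : j = i₀
    · subst hj
      rw [shear_X_self]
      simp [a]
    · rw [shear_X_of_ne _ _ hj]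
      simp [a, hj, Polynomial.algebraMap_eq, sub_eq_add_neg]
  have hdvd : C.poly ∣ shear i₀ (-v) H := by
    rw [poly_dvd_iff hker (shear_isHomogeneous _ _ hH), ← hHa]
    exact DFunLike.congr_fun hcomp H
  have hdvd' : shear i₀ v C.poly ∣ H := by
    have := map_dvd (shear i₀ v) hdvd
    rwa [shear_neg_shear] at this
  exact (degreeOf_le_of_dvd hH0 hdvd' i₀).trans hHD

variable [IsAlgClosed k] (hm : IsFrobeniusIndex k m)
  (hker : RingHom.ker (paramHom k m) = Ideal.span {C.poly})
include hm hker

/-- The projection from `(0:1:0)` has degree `2m`, and the degree of the equation in the second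
variable bounds it from above. -/
theorem two_mul_le_degreeOf_one : 2 * m ≤ C.poly.degreeOf 1 := by
  have h2 := hm.two_le
  have := finrank_adjoin_le_degreeOf (affineParam k m) (i₀ := 1) (i₁ := 0) (i₂ := 2) (by decide)
    (by decide) (by decide) hm.affineParam_two_ne_zero rfl rfl
    (fun L h h' => hm.adjoin_eq_top h h')
    (RatFunc.transcendental_of_finrank_pos (by
      rw [affineParam_zero, affineParam_two, hm.finrank_zero_div_two]; omega))
    C.irreducible.ne_zero C.homogeneous (aeval_affineParam_poly hker)
  rwa [affineParam_zero, affineParam_two, hm.finrank_zero_div_two] at this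

theorem two_mul_le_degreeOf_zero : 2 * m ≤ C.poly.degreeOf 0 := by
  have h2 := hm.two_le
  have := finrank_adjoin_le_degreeOf (affineParam k m) (i₀ := 0) (i₁ := 1) (i₂ := 2) (by decide)
    (by decide) (by decide) hm.affineParam_two_ne_zero rfl rfl
    (fun L h h' => hm.adjoin_eq_top h' h)
    (RatFunc.transcendental_of_finrank_pos (by
      rw [affineParam_one, affineParam_two, hm.finrank_one_div_two]; omega))
    C.irreducible.ne_zero C.homogeneous (aeval_affineParam_poly hker)
  rwa [affineParam_one, affineParam_two, hm.finrank_one_div_two] at this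

/-- Upper bound: by `not_common_root` the point `(1 : (-1)^m : 0)` is off the curve, so after a
shear the total degree is attained in one variable, where it is at most `2m + 1`. Lower bound:
`(0:1:0)` is on the curve, so the total degree exceeds the degree in the second variable, which is
at least `2m`. -/
theorem totalDegree_poly : C.poly.totalDegree = 2 * m + 1 := by
  have h2 := hm.two_le
  apply le_antisymm
  · have hv : eval ![1, (-1) ^ m, 0] C.poly ≠ 0 := by
      intro h
      obtain ⟨u, hu⟩ := exists_phi2Vec_eq (k := k) (m := m) (by omega)
        (w := ![1, (-1) ^ m, 0]) (by
          intro H hH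
          rw [hker, Ideal.mem_span_singleton] at hH
          obtain ⟨Q, rfl⟩ := hH
          rw [map_mul, h, zero_mul])
      have e1 : (2 * m + 1 + 1) / 2 = m + 1 := by omega
      have x := congrFun hu 0
      have y := congrFun hu 1
      have z := congrFun hu 2
      simp [phi2Vec, e1] at x y z
      have hu1 : u 1 ≠ 0 := by
        intro h
        rw [h, zero_pow (by omega), mul_zero] at x
        exact zero_ne_one x
      obtain ⟨s, hs⟩ : ∃ s, u 0 = u 1 * s := ⟨u 0 / u 1, (mul_div_cancel₀ _ hu1).symm⟩
      have hs1 : u 0 - u 1 = u 1 * (s - 1) := by rw [hs]; ring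
      rw [hs1] at y
      rw [hs] at x z
      have hp : u 1 ^ (2 * m + 1) ≠ 0 := pow_ne_zero _ hu1
      apply hm.not_common_root s
      · apply mul_left_cancel₀ hp
        rw [mul_zero, ← z]
        ring
      · have : u 1 ^ (2 * m + 1) * ((s - 1) ^ (m + 1)) =
            (-1) ^ m * (u 1 ^ (2 * m + 1) * s ^ (m + 1)) := by
          have y' : u 1 ^ (2 * m + 1) * ((s - 1) ^ (m + 1)) = (-1) ^ m := by
            rw [← y, mul_pow]
            ring
          have x' : u 1 ^ (2 * m + 1) * s ^ (m + 1) = 1 := by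
            rw [← x, mul_pow]
            ring
          rw [y', x', mul_one]
        apply mul_left_cancel₀ hp
        linear_combination this
    refine (le_degreeOf_shear (i := 0) (by simp) C.homogeneous hv).trans ?_
    refine degreeOf_shear_poly_le hker (i₁ := 1) (i₂ := 2) (by decide) (by decide) (by decide) _
      (one_mul _).symm (one_mul _).symm ?_ ?_
    · refine (natDegree_sub_one_pow_sub_le _).trans ?_
      omega
    · simpa using hm.natDegree_affineParam_two.le
  · have h := two_mul_le_degreeOf_one hm hker
    have := degreeOf_lt_of_eval_single_eq_zero (i := 1) (n := C.poly.totalDegree) (by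
      have := degreeOf_le_totalDegree C.poly 1
      omega) C.homogeneous (eval_single_one_poly hker)
    omega

theorem exists_pderiv_single_one_ne_zero : ∃ j, eval (Pi.single 1 1) (pderiv j C.poly) ≠ 0 := by
  have h2 := hm.two_le
  have := totalDegree_poly hm hker
  have := two_mul_le_degreeOf_one hm hker
  exact exists_eval_single_pderiv_ne_zero (by omega) C.homogeneous (eval_single_one_poly hker)
    (by omega)

theorem exists_pderiv_single_zero_ne_zero : ∃ j, eval (Pi.single 0 1) (pderiv j C.poly) ≠ 0 := by
  have h2 := hm.two_le
  have := totalDegree_poly hm hker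
  have := two_mul_le_degreeOf_zero hm hker
  exact exists_eval_single_pderiv_ne_zero (by omega) C.homogeneous (eval_single_zero_poly hker)
    (by omega)

/-- The linear forms vanishing at a smooth point `v` do not have a common factor with cofactors of
degree at most `D`, for `D < 2m`. -/
theorem two_mul_le_of_smooth {i₀ i₁ i₂ : Fin 3} (h01 : i₀ ≠ i₁)
    (h02 : i₀ ≠ i₂) (h12 : i₁ ≠ i₂) {v : Fin 3 → k} (hv : v i₀ = 1)
    (hsm : ∃ j, eval v (pderiv j C.poly) ≠ 0) {D : ℕ} {c b₁ b₂ : Polynomial k}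
    (h₁ : affineParam k m i₁ - Polynomial.C (v i₁) * affineParam k m i₀ = c * b₁)
    (h₂ : affineParam k m i₂ - Polynomial.C (v i₂) * affineParam k m i₀ = c * b₂)
    (hb₁ : b₁.natDegree ≤ D) (hb₂ : b₂.natDegree ≤ D) : 2 * m ≤ D := by
  have h1 := degreeOf_shear_poly_le hker h01 h02 h12 v h₁ h₂ hb₁ hb₂
  have h2 := le_degreeOf_shear_add_one hv C.homogeneous hsm
  rw [totalDegree_poly hm hker] at h2
  omega

/-- The linear forms through `(0:0:1)` restrict to polynomials of degree at most `m + 1 < 2m`, too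
small for a smooth point. -/
theorem pderiv_single_two_eq_zero (j : Fin 3) : eval (Pi.single 2 1) (pderiv j C.poly) = 0 := by
  by_contra hne
  have h2 := hm.two_le
  have := two_mul_le_of_smooth hm hker (i₀ := 2) (i₁ := 0) (i₂ := 1) (by decide) (by decide)
    (by decide) (v := Pi.single 2 1) (by simp) ⟨j, hne⟩ (D := m + 1) (one_mul _).symm
    (one_mul _).symm (by simp) (by
      have : ((Polynomial.X - Polynomial.C 1 : Polynomial k) ^ (m + 1)).natDegree ≤ m + 1 := by
        rw [Polynomial.natDegree_pow, Polynomial.natDegree_X_sub_C, mul_one]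
      simpa using this)
  omega

end PlaneCurve

end SmoothPoints

/-! ### The function field and its projection subfields inside `k(X)`. -/

section FunctionField

open MvPolynomial

variable {k : Type*} [Field k] {m : ℕ} {C : PlaneCurve k}

theorem fin_three_sum {A : Type*} [AddCommMonoid A] {i₀ i₁ i₂ : Fin 3} (h01 : i₀ ≠ i₁)
    (h02 : i₀ ≠ i₂) (h12 : i₁ ≠ i₂) (f : Fin 3 → A) : ∑ i, f i = f i₀ + f i₁ + f i₂ := by
  have : (Finset.univ : Finset (Fin 3)) = {i₀, i₁, i₂} := by
    ext i
    simpa using fin_three_eq_or h01 h02 h12 i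
  rw [this, Finset.sum_insert (by simp [h01, h02]), Finset.sum_insert (by simp [h12]),
    Finset.sum_singleton, add_assoc]

namespace PlaneCurve

theorem toConeField_eq_zero_iff (H : MvPolynomial (Fin 3) k) :
    C.toConeField H = 0 ↔ C.poly ∣ H := by
  have : C.toConeField H =
      algebraMap C.CoordRing C.ConeField (Ideal.Quotient.mk (Ideal.span {C.poly}) H) := rfl
  rw [this, FaithfulSMul.algebraMap_eq_zero_iff, Ideal.Quotient.eq_zero_iff_mem,
    Ideal.mem_span_singleton]

/-- The restriction of a form to the affine part of the parametrizing line. -/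
noncomputable def toRatFunc (m : ℕ) : MvPolynomial (Fin 3) k →ₐ[k] RatFunc k :=
  (IsScalarTower.toAlgHom k (Polynomial k) (RatFunc k)).comp (aeval (affineParam k m))

theorem toRatFunc_apply (H : MvPolynomial (Fin 3) k) :
    toRatFunc m H = algebraMap (Polynomial k) (RatFunc k) (aeval (affineParam k m) H) := rfl

theorem toRatFunc_eq_zero_iff [Infinite k]
    (hker : RingHom.ker (paramHom k m) = Ideal.span {C.poly})
    {H : MvPolynomial (Fin 3) k} {d : ℕ} (hH : H.IsHomogeneous d) :
    toRatFunc m H = 0 ↔ C.toConeField H = 0 := by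
  rw [toRatFunc_apply, FaithfulSMul.algebraMap_eq_zero_iff, toConeField_eq_zero_iff,
    poly_dvd_iff hker hH]

/-- The restriction of a rational function on the curve to the parametrizing line. -/
noncomputable def pullbackFun (m : ℕ) (x : C.functionField) : RatFunc k :=
  toRatFunc m x.2.choose_spec.choose / toRatFunc m x.2.choose_spec.choose_spec.choose

/-- Independence of the chosen quotient: a form vanishes on the curve exactly when it vanishes along
the parametrization, and this applies to the cross-multiplied difference. -/
theorem pullbackFun_eq [Infinite k] (hker : RingHom.ker (paramHom k m) = Ideal.span {C.poly})
    {x : C.functionField} {d : ℕ} {a b : MvPolynomial (Fin 3) k} (ha : a.IsHomogeneous d)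
    (hb : b.IsHomogeneous d) (hb0 : C.toConeField b ≠ 0)
    (hx : (x : C.ConeField) = C.toConeField a / C.toConeField b) :
    pullbackFun m x = toRatFunc m a / toRatFunc m b := by
  obtain ⟨ha', hb', hb0', hx'⟩ := x.2.choose_spec.choose_spec.choose_spec
  set a' := x.2.choose_spec.choose with ha'_def
  set b' := x.2.choose_spec.choose_spec.choose with hb'_def
  set d' := x.2.choose
  change toRatFunc m a' / toRatFunc m b' = _
  have hx'' : (x : C.ConeField) = C.toConeField a' / C.toConeField b' := hx'
  rw [div_eq_div_iff (fun h => hb0' ((toRatFunc_eq_zero_iff hker hb').1 h))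
    (fun h => hb0 ((toRatFunc_eq_zero_iff hker hb).1 h)), ← map_mul, ← map_mul, ← sub_eq_zero,
    ← map_sub, toRatFunc_eq_zero_iff hker ((ha'.mul hb).sub (by
      rw [add_comm]; exact ha.mul hb')), map_sub, map_mul, map_mul, sub_eq_zero,
    ← div_eq_div_iff hb0' hb0, ← hx, ← hx'']

/-- The restriction of rational functions on the curve to the parametrizing line. -/
noncomputable def pullback [Infinite k]
    (hker : RingHom.ker (paramHom k m) = Ideal.span {C.poly}) :
    C.functionField →ₐ[k] RatFunc k where
  toFun := pullbackFun m
  map_one' := by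
    rw [pullbackFun_eq hker (isHomogeneous_one _ _) (isHomogeneous_one _ _)
      (by rw [map_one]; exact one_ne_zero) (by simp)]
    simp
  map_zero' := by
    rw [pullbackFun_eq hker (isHomogeneous_zero _ _ 0) (isHomogeneous_one _ _)
      (by rw [map_one]; exact one_ne_zero) (by simp)]
    simp
  map_mul' := by
    intro x y
    obtain ⟨d, a, b, ha, hb, hb0, hx⟩ := x.2
    obtain ⟨d', a', b', ha', hb', hb0', hy⟩ := y.2
    rw [pullbackFun_eq hker ha hb hb0 hx, pullbackFun_eq hker ha' hb' hb0' hy,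
      pullbackFun_eq hker (ha.mul ha') (hb.mul hb')
      (by rw [map_mul]; exact mul_ne_zero hb0 hb0') (by
        rw [map_mul, map_mul, ← div_mul_div_comm, ← hx, ← hy]; rfl), map_mul, map_mul,
      div_mul_div_comm]
  map_add' := by
    intro x y
    obtain ⟨d, a, b, ha, hb, hb0, hx⟩ := x.2
    obtain ⟨d', a', b', ha', hb', hb0', hy⟩ := y.2
    rw [pullbackFun_eq hker ha hb hb0 hx, pullbackFun_eq hker ha' hb' hb0' hy,
      pullbackFun_eq hker ((ha.mul hb').add (hb.mul ha')) (hb.mul hb')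
      (by rw [map_mul]; exact mul_ne_zero hb0 hb0') (by
        rw [map_add, map_mul, map_mul, map_mul, ← div_add_div _ _ hb0 hb0', ← hx, ← hy]; rfl),
      map_add, map_mul, map_mul, map_mul,
      div_add_div _ _ (fun h => hb0 ((toRatFunc_eq_zero_iff hker hb).1 h))
        (fun h => hb0' ((toRatFunc_eq_zero_iff hker hb').1 h))]
  commutes' := by
    intro r
    rw [pullbackFun_eq hker (isHomogeneous_C _ r) (isHomogeneous_one _ _)
      (by rw [map_one]; exact one_ne_zero) (by
        rw [map_one, div_one]; exact (C.toConeField.commutes r).symm), map_one, div_one]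
    exact (toRatFunc m).commutes r

/-- The quotient of two forms of the same degree, as a rational function on the curve. -/
theorem exists_pullback_eq [Infinite k]
    (hker : RingHom.ker (paramHom k m) = Ideal.span {C.poly}) {d : ℕ}
    {a b : MvPolynomial (Fin 3) k} (ha : a.IsHomogeneous d) (hb : b.IsHomogeneous d)
    (hb0 : C.toConeField b ≠ 0) :
    ∃ x : C.functionField, (x : C.ConeField) = C.toConeField a / C.toConeField b ∧
      pullback hker x = toRatFunc m a / toRatFunc m b :=
  ⟨⟨_, d, a, b, ha, hb, hb0, rfl⟩, rfl, pullbackFun_eq hker ha hb hb0 rfl⟩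

/-- The image contains both affine coordinate functions, so `adjoin_eq_top` gives surjectivity. -/
theorem pullback_bijective [IsAlgClosed k] (hm : IsFrobeniusIndex k m)
    (hker : RingHom.ker (paramHom k m) = Ideal.span {C.poly}) :
    Function.Bijective (pullback hker) := by
  refine ⟨(pullback hker).toRingHom.injective, ?_⟩
  have hX : ∀ i, toRatFunc m (X i) = algebraMap (Polynomial k) (RatFunc k) (affineParam k m i) := by
    intro i
    rw [toRatFunc_apply, aeval_X]
  have h2 : C.toConeField (X 2) ≠ 0 := by
    rw [Ne, ← toRatFunc_eq_zero_iff hker (isHomogeneous_X _ _), hX]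
    exact RatFunc.algebraMap_ne_zero hm.affineParam_two_ne_zero
  have hmem : ∀ i, algebraMap (Polynomial k) (RatFunc k) (affineParam k m i) /
      algebraMap (Polynomial k) (RatFunc k) (affineParam k m 2) ∈ (pullback hker).fieldRange := by
    intro i
    obtain ⟨x, -, hx⟩ := exists_pullback_eq hker (isHomogeneous_X k i) (isHomogeneous_X k 2) h2
    rw [hX, hX] at hx
    exact ⟨x, hx⟩
  have := hm.adjoin_eq_top (hmem 0) (hmem 1)
  exact AlgHom.fieldRange_eq_top.1 this

/-- The parametrization identifies the function field of the curve with the field of rational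
functions. -/
noncomputable def functionFieldEquiv [IsAlgClosed k] (hm : IsFrobeniusIndex k m)
    (hker : RingHom.ker (paramHom k m) = Ideal.span {C.poly}) :
    C.functionField ≃ₐ[k] RatFunc k :=
  AlgEquiv.ofBijective (pullback hker) (pullback_bijective hm hker)

theorem exists_linear_combination {a : MvPolynomial (Fin 3) k} (ha : a.IsHomogeneous 1)
    {i₀ i₁ i₂ : Fin 3} (h01 : i₀ ≠ i₁) (h02 : i₀ ≠ i₂) (h12 : i₁ ≠ i₂) {v : Fin 3 → k}
    (hv : v i₀ = 1) (hav : eval v a = 0) : ∃ r s : k, a =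
      MvPolynomial.C r * (X i₁ - MvPolynomial.C (v i₁) * X i₀) +
        MvPolynomial.C s * (X i₂ - MvPolynomial.C (v i₂) * X i₀) := by
  have : a ∈ homogeneousSubmodule (Fin 3) k 1 := ha
  rw [homogeneousSubmodule_one_eq_span_X, Submodule.mem_span_range_iff_exists_fun] at this
  obtain ⟨c, rfl⟩ := this
  rw [fin_three_sum h01 h02 h12] at hav ⊢
  simp only [map_add, smul_eval, eval_X, hv, mul_one] at hav
  refine ⟨c i₁, c i₂, ?_⟩
  simp only [smul_eq_C_mul]
  have hc : c i₀ = -(c i₁ * v i₁ + c i₂ * v i₂) := by linear_combination hav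
  rw [hc, C_neg, C_add, C_mul, C_mul]
  ring

/-- Linear forms vanishing at `v` are combinations of the two forms that restrict to `f` and `g`.
Divided by `g` they become `r h + s` with `h = f / g`, so every generator lies in `k(h)`. -/
theorem map_projectionField [IsAlgClosed k] (hm : IsFrobeniusIndex k m)
    (hker : RingHom.ker (paramHom k m) = Ideal.span {C.poly}) {i₀ i₁ i₂ : Fin 3} (h01 : i₀ ≠ i₁)
    (h02 : i₀ ≠ i₂) (h12 : i₁ ≠ i₂) {v : Fin 3 → k} (hv : v i₀ = 1) (hv0 : v ≠ 0)
    {f g : Polynomial k}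
    (hf : affineParam k m i₁ - Polynomial.C (v i₁) * affineParam k m i₀ = f)
    (hg : affineParam k m i₂ - Polynomial.C (v i₂) * affineParam k m i₀ = g) (hg0 : g ≠ 0) :
    (C.projectionField (Projectivization.mk k v hv0)).map (functionFieldEquiv hm hker).toAlgHom =
      IntermediateField.adjoin k {algebraMap (Polynomial k) (RatFunc k) f /
        algebraMap (Polynomial k) (RatFunc k) g} := by
  have hl : ∀ i, (X i - MvPolynomial.C (v i) * X i₀ : MvPolynomial (Fin 3) k).IsHomogeneous 1 :=
    fun i => (isHomogeneous_X _ _).sub ((isHomogeneous_X _ _).C_mul _)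
  have hl0 : ∀ i, eval (Projectivization.mk k v hv0).rep
      (X i - MvPolynomial.C (v i) * X i₀ : MvPolynomial (Fin 3) k) = 0 := by
    intro i
    rw [(hl i).eval_rep_mk_eq_zero_iff]
    simp [hv]
  have hr : ∀ i, toRatFunc m (X i - MvPolynomial.C (v i) * X i₀) =
      algebraMap (Polynomial k) (RatFunc k)
        (affineParam k m i - Polynomial.C (v i) * affineParam k m i₀) := by
    intro i
    rw [toRatFunc_apply]
    congr 1
    simp [Polynomial.algebraMap_eq]
  have hgne := RatFunc.algebraMap_ne_zero hg0
  have hl2 : C.toConeField (X i₂ - MvPolynomial.C (v i₂) * X i₀) ≠ 0 := by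
    rw [Ne, ← toRatFunc_eq_zero_iff hker (hl i₂), hr, hg]
    exact hgne
  set h := algebraMap (Polynomial k) (RatFunc k) f / algebraMap (Polynomial k) (RatFunc k) g with hh
  rw [projectionField, IntermediateField.adjoin_map]
  apply le_antisymm
  · rw [IntermediateField.adjoin_le_iff]
    rintro _ ⟨x, ⟨a, b, ha, hb, hav, hbv, hb0, hx⟩, rfl⟩
    rw [ha.eval_rep_mk_eq_zero_iff] at hav
    rw [hb.eval_rep_mk_eq_zero_iff] at hbv
    have hx' : functionFieldEquiv hm hker x = toRatFunc m a / toRatFunc m b :=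
      pullbackFun_eq hker ha hb hb0 hx
    change functionFieldEquiv hm hker x ∈ IntermediateField.adjoin k {h}
    have key : ∀ c : MvPolynomial (Fin 3) k, c.IsHomogeneous 1 → eval v c = 0 →
        toRatFunc m c / algebraMap (Polynomial k) (RatFunc k) g ∈
          IntermediateField.adjoin k {h} := by
      intro c hc hcv
      obtain ⟨r, s, rfl⟩ := exists_linear_combination hc h01 h02 h12 hv hcv
      have hC : ∀ r, toRatFunc m (MvPolynomial.C r) = algebraMap k (RatFunc k) r :=
        (toRatFunc m).commutes
      rw [map_add, map_mul, map_mul, hr, hr, hf, hg, hC, hC, add_div, mul_div_assoc, mul_div_assoc,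
        div_self hgne, ← hh, mul_one]
      exact add_mem (mul_mem (IntermediateField.algebraMap_mem _ _)
        (IntermediateField.mem_adjoin_simple_self k h)) (IntermediateField.algebraMap_mem _ _)
    rw [hx', ← div_div_div_cancel_right₀ hgne]
    exact div_mem (key a ha hav) (key b hb hbv)
  · rw [IntermediateField.adjoin_simple_le_iff]
    obtain ⟨x, hx1, hx2⟩ := exists_pullback_eq hker (hl i₁) (hl i₂) hl2
    apply IntermediateField.subset_adjoin
    refine ⟨x, ⟨_, _, hl i₁, hl i₂, hl0 i₁, hl0 i₂, hl2, hx1⟩, ?_⟩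
    rw [hr, hr, hf, hg] at hx2
    exact hx2

end PlaneCurve

end FunctionField

/-! ### Unequal ramification over a point excludes a Galois extension. -/

section Ramification

open Polynomial IntermediateField algebraAdjoinAdjoin WithZero

variable {k : Type*} [Field k]

/-- The height one prime of `k[X]` corresponding to the point `c` of the affine line. -/
noncomputable def heightOneSpectrumXSubC (c : k) : IsDedekindDomain.HeightOneSpectrum k[X] where
  asIdeal := Ideal.span {X - C c}
  isPrime := (Ideal.span_singleton_prime (X_sub_C_ne_zero c)).2 (prime_X_sub_C c)
  ne_bot := by
    rw [Ne, Ideal.span_singleton_eq_bot]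
    exact X_sub_C_ne_zero c

theorem valuation_X_sub_C (c : k) : (heightOneSpectrumXSubC c).valuation (RatFunc k)
    (algebraMap k[X] (RatFunc k) (X - C c)) = exp (-1 : ℤ) := by
  rw [IsDedekindDomain.HeightOneSpectrum.valuation_of_algebraMap,
    IsDedekindDomain.HeightOneSpectrum.intValuation_singleton _ (X_sub_C_ne_zero c) rfl]

theorem valuation_eq_one_of_eval_ne_zero {c : k} {p : k[X]} (hp : p.eval c ≠ 0) :
    (heightOneSpectrumXSubC c).valuation (RatFunc k) (algebraMap k[X] (RatFunc k) p) = 1 := by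
  rw [IsDedekindDomain.HeightOneSpectrum.valuation_of_algebraMap,
    IsDedekindDomain.HeightOneSpectrum.intValuation_eq_one_iff]
  intro h
  have h' : p ∈ Ideal.span {X - C c} := h
  rw [Ideal.mem_span_singleton, dvd_iff_isRoot] at h'
  exact hp h'

instance (c : k) :
    ((heightOneSpectrumXSubC c).valuation (RatFunc k)).IsTrivialOn k where
  eq_one a ha := by
    rw [IsScalarTower.algebraMap_apply k k[X] (RatFunc k)]
    exact valuation_eq_one_of_eval_ne_zero (by simpa using ha)

namespace RatFunc

theorem map_minpolyX (h : RatFunc k) : (h.minpolyX k⟮h⟯).map (algebraMap k⟮h⟯ (RatFunc k)) =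
    h.num.map (algebraMap k (RatFunc k)) -
      Polynomial.C h * h.denom.map (algebraMap k (RatFunc k)) := by
  rw [minpolyX, Polynomial.map_sub, Polynomial.map_mul, Polynomial.map_C, Polynomial.map_map,
    Polynomial.map_map, ← IsScalarTower.algebraMap_eq]
  rfl

/-- The polynomial `num(T) - h denom(T)` is irreducible over `k(h)` with root `X`, so it is a
constant multiple of the minimal polynomial of `X`, and normality splits it. -/
theorem splits_minpolyX {h : RatFunc k} (hh : ¬ ∃ c, h = C c)
    (hG : IsGalois k⟮h⟯ (RatFunc k)) : (h.num.map (algebraMap k (RatFunc k)) -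
      Polynomial.C h * h.denom.map (algebraMap k (RatFunc k))).Splits := by
  rw [← map_minpolyX]
  have h1 := hG.to_normal.splits (X : RatFunc k)
  have hirr := h.irreducible_minpolyX hh
  rw [← minpoly.eq_of_irreducible hirr h.minpolyX_aeval_X, Polynomial.map_mul] at h1
  refine h1.of_dvd ?_ (dvd_mul_right _ _)
  rw [← Polynomial.map_mul, Polynomial.map_ne_zero_iff (algebraMap k⟮h⟯ (RatFunc k)).injective]
  exact mul_ne_zero hirr.ne_zero
    (Polynomial.C_ne_zero.2 (inv_ne_zero (leadingCoeff_ne_zero.2 hirr.ne_zero)))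

/-- The extension `k(X) / k(h)` is not Galois if `h` has both a simple zero on the affine line and
a multiple zero at infinity. -/
theorem not_isGalois_of_simple_zero {f g : k[X]} {c : k} (hf : f.eval c = 0)
    (hf' : f.derivative.eval c ≠ 0) (hg : g.eval c ≠ 0) (hdeg : f.natDegree + 2 ≤ g.natDegree) :
    ¬ IsGalois k⟮algebraMap k[X] (RatFunc k) f / algebraMap k[X] (RatFunc k) g⟯ (RatFunc k) := by
  intro hG
  set h := algebraMap k[X] (RatFunc k) f / algebraMap k[X] (RatFunc k) g with hh
  have hg0 : g ≠ 0 := by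
    rintro rfl
    simp at hg
  have hf0 : f ≠ 0 := by
    rintro rfl
    simp at hf'
  have hh0 : h ≠ 0 := div_ne_zero (algebraMap_ne_zero hf0) (algebraMap_ne_zero hg0)
  have hnd : h.num * g = f * h.denom := (num_mul_eq_mul_denom_iff hg0).2 hh
  have hnum0 : h.num ≠ 0 := num_ne_zero hh0
  have hden0 : h.denom ≠ 0 := denom_ne_zero h
  have hdeg' : h.num.natDegree + 2 ≤ h.denom.natDegree := by
    have := congrArg natDegree hnd
    rw [natDegree_mul hnum0 hg0, natDegree_mul hf0 hden0] at this
    omega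
  have hnc : h.num.eval c = 0 := by
    have := congrArg (Polynomial.eval c) hnd
    rw [Polynomial.eval_mul, Polynomial.eval_mul, hf, zero_mul] at this
    exact (mul_eq_zero.1 this).resolve_right hg
  have hdc : h.denom.eval c ≠ 0 := by
    obtain ⟨u, w, huw⟩ := isCoprime_num_denom h
    intro hz
    have := congrArg (Polynomial.eval c) huw
    simp [hnc, hz] at this
  have hnC : ¬ ∃ c, h = C c := by
    rw [eq_C_iff]
    omega
  let v := (heightOneSpectrumXSubC c).valuation (RatFunc k)
  have hvh : v h = exp (-1 : ℤ) := by
    obtain ⟨f₂, hf₂⟩ := dvd_iff_isRoot.2 hf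
    have : f₂.eval c ≠ 0 := by
      intro hz
      rw [hf₂] at hf'
      simp [derivative_mul, hz] at hf'
    rw [hh, map_div₀, hf₂, map_mul, map_mul, valuation_X_sub_C,
      valuation_eq_one_of_eval_ne_zero this, valuation_eq_one_of_eval_ne_zero hg, mul_one, div_one]
  set N := h.num.map (algebraMap k (RatFunc k)) -
      Polynomial.C h * h.denom.map (algebraMap k (RatFunc k)) with hN
  have hsplit : N.Splits := splits_minpolyX hnC hG
  have hlt : (h.num.map (algebraMap k (RatFunc k))).degree <
      (Polynomial.C h * h.denom.map (algebraMap k (RatFunc k))).degree := by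
    apply degree_lt_degree
    rw [natDegree_C_mul hh0, natDegree_map, natDegree_map]
    omega
  have hlc : N.leadingCoeff = -(h * algebraMap k (RatFunc k) h.denom.leadingCoeff) := by
    rw [hN, leadingCoeff_sub_of_degree_lt' hlt, leadingCoeff_mul, leadingCoeff_C, leadingCoeff_map]
  have hN0 : N ≠ 0 := by
    rw [← leadingCoeff_ne_zero, hlc, neg_ne_zero]
    exact mul_ne_zero hh0 (by simpa using hden0)
  have hvconst : ∀ a : k, a ≠ 0 → v (algebraMap k (RatFunc k) a) = 1 := fun a ha =>
    Valuation.IsTrivialOn.eq_one a ha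
  -- `N(c) = -h denom(c)`, and the leading coefficient is `-h` times a constant: `h` cancels and the
  -- product of the `c - a` over the roots is a nonzero constant.
  have hprod : v (N.roots.map (algebraMap k (RatFunc k) c - ·)).prod = 1 := by
    have h1 := hsplit.eval_eq_prod_roots (algebraMap k (RatFunc k) c)
    rw [hlc, hN, Polynomial.eval_sub, Polynomial.eval_mul, Polynomial.eval_C,
      Polynomial.eval_map_algebraMap, Polynomial.eval_map_algebraMap,
      Polynomial.aeval_algebraMap_apply, Polynomial.aeval_algebraMap_apply,
      Polynomial.coe_aeval_eq_eval, hnc, map_zero, zero_sub, neg_mul, neg_inj, mul_assoc] at h1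
    have h2 := congrArg v (mul_left_cancel₀ hh0 h1)
    rw [hvconst _ hdc, map_mul, hvconst _ (leadingCoeff_ne_zero.2 hden0), one_mul] at h2
    exact h2.symm
  have hXroot : (X : RatFunc k) ∈ N.roots := by
    rw [mem_roots hN0, IsRoot, hN, ← map_minpolyX, eval_map_algebraMap]
    exact h.minpolyX_aeval_X
  have hvX : v (algebraMap k (RatFunc k) c - X) = exp (-1 : ℤ) := by
    rw [← valuation_X_sub_C c, ← Valuation.map_neg, map_sub, algebraMap_X, algebraMap_C, neg_sub,
      algebraMap_eq_C]
  -- The root `X` contributes a value below 1, so some conjugate `a` must compensate; it has a pole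
  -- at `c`.
  obtain ⟨a, ha, hva⟩ : ∃ a ∈ N.roots, 1 < v (algebraMap k (RatFunc k) c - a) := by
    by_contra! hcon
    obtain ⟨s, hs⟩ := Multiset.exists_cons_of_mem hXroot
    rw [hs, Multiset.map_cons, Multiset.prod_cons, map_mul, hvX] at hprod
    have h1 : v (s.map (algebraMap k (RatFunc k) c - ·)).prod ≤ 1 := by
      have hs' : ∀ a ∈ s, v (algebraMap k (RatFunc k) c - a) ≤ 1 := fun a ha =>
        hcon a (by rw [hs]; exact Multiset.mem_cons_of_mem ha)
      clear hs hprod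
      induction s using Multiset.induction with
      | empty => simp
      | cons a s ih =>
        rw [Multiset.map_cons, Multiset.prod_cons, map_mul]
        exact mul_le_one' (hs' a (Multiset.mem_cons_self a s))
          (ih fun b hb => hs' b (Multiset.mem_cons_of_mem hb))
    have h2 : exp (-1 : ℤ) * v (s.map (algebraMap k (RatFunc k) c - ·)).prod < 1 :=
      lt_of_le_of_lt (mul_le_of_le_one_right' h1) (by decide)
    exact absurd hprod h2.ne
  have hva' : 1 < v a := by
    by_contra! hle
    exact absurd hva (not_lt.2 (v.map_sub_le
      (Valuation.IsTrivialOn.valuation_algebraMap_le_one v c) hle))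
  have hroot : Polynomial.aeval a h.num = h * Polynomial.aeval a h.denom := by
    rw [mem_roots hN0, IsRoot, hN, Polynomial.eval_sub, Polynomial.eval_mul, Polynomial.eval_C,
      eval_map_algebraMap, eval_map_algebraMap, sub_eq_zero] at ha
    exact ha
  have hval := congrArg v hroot
  rw [map_mul, valuation_aeval_eq_valuation_X_pow_natDegree_of_one_lt_valuation_X a hva' hnum0,
    valuation_aeval_eq_valuation_X_pow_natDegree_of_one_lt_valuation_X a hva' hden0, hvh] at hval
  have hva0 : v a ≠ 0 := (zero_lt_one.trans hva').ne'
  rw [← exp_log hva0, ← exp_nsmul, ← exp_nsmul, ← exp_add, exp_inj] at hval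
  simp only [nsmul_eq_mul] at hval
  -- The pole order of `a` times the order of the zero of `h` at infinity equals the order 1 of its
  -- zero at `c`, which contradicts a degree gap of at least 2.
  have h3 : (((h.denom.natDegree : ℤ) - h.num.natDegree) * log (v a)) = 1 := by
    linear_combination -hval
  have h4 : ((h.denom.natDegree : ℤ) - h.num.natDegree) ∣ 1 := ⟨_, h3.symm⟩
  have h5 := Int.le_of_dvd one_pos h4
  omega

end RatFunc

end Ramification

/-! ### Determination of the inner Galois points. -/

section GaloisPoints

open Polynomial IntermediateField

namespace Polynomial

theorem dvd_of_separable_of_isRoot {k : Type*} [Field k] [IsAlgClosed k] {f g : k[X]}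
    (hf : f.Separable) (h : ∀ c, f.eval c = 0 → g.eval c = 0) : f ∣ g := by
  classical
  rcases eq_or_ne g 0 with rfl | hg
  · exact dvd_zero f
  rw [(IsAlgClosed.splits f).dvd_iff_roots_le_roots hf.ne_zero hg,
    Multiset.le_iff_subset (nodup_roots hf)]
  intro c hc
  exact (mem_roots hg).2 (h c (mem_roots hf.ne_zero |>.1 hc))

end Polynomial

variable {k : Type*} [Field k] {m : ℕ}

namespace IsFrobeniusIndex

/-- As `m + 1` is invertible in `k`, a double root `c` satisfies `(c-1)^m = b c^m`. Together with
the equation this gives `b c^m = 0`, hence both `c = 0` and `c = 1`. -/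
theorem eval_derivative_sub_one_pow_sub_ne_zero (hm : IsFrobeniusIndex k m) {b : k} (hb : b ≠ 0)
    {c : k} (hc : ((X - 1) ^ (m + 1) - C b * X ^ (m + 1) : k[X]).eval c = 0) :
    ((X - 1) ^ (m + 1) - C b * X ^ (m + 1) : k[X]).derivative.eval c ≠ 0 := by
  intro hc'
  have h2 := hm.two_le
  have h1 : (c - 1) ^ (m + 1) - b * c ^ (m + 1) = 0 := by simpa using hc
  have h3 : (m + 1 : k) * ((c - 1) ^ m - b * c ^ m) = 0 := by
    simp [derivative_pow, derivative_sub] at hc'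
    linear_combination hc'
  have h4 := (mul_eq_zero.1 h3).resolve_left hm.cast_add_one_ne_zero
  have h5 : b * c ^ m = 0 := by linear_combination (c - 1) * h4 - h1
  have h6 : c ^ m = 0 := (mul_eq_zero.1 h5).resolve_left hb
  have h7 : (c - 1) ^ m = 0 := by linear_combination h4 + h5
  have h8 : c = 0 := eq_zero_of_pow_eq_zero h6
  have h9 : c - 1 = 0 := eq_zero_of_pow_eq_zero h7
  rw [h8] at h9
  simp at h9

theorem separable_sub_one_pow_sub [IsAlgClosed k] (hm : IsFrobeniusIndex k m) {b : k}
    (hb : b ≠ 0) : ((X - 1) ^ (m + 1) - C b * X ^ (m + 1) : k[X]).Separable := by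
  rw [Separable, isCoprime_iff_aeval_ne_zero_of_isAlgClosed k k]
  intro c
  rw [or_iff_not_imp_left, not_not, coe_aeval_eq_eval]
  exact hm.eval_derivative_sub_one_pow_sub_ne_zero hb

/-- For `b = 1` the leading terms cancel, but the coefficient `-(m+1)` of `X^m` survives. -/
theorem le_natDegree_sub_one_pow_sub (hm : IsFrobeniusIndex k m) (b : k) :
    m ≤ ((X - 1) ^ (m + 1) - C b * X ^ (m + 1) : k[X]).natDegree := by
  apply le_natDegree_of_ne_zero
  rw [coeff_sub, coeff_C_mul, coeff_X_pow, if_neg (by omega), mul_zero, sub_zero, sub_eq_add_neg,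
    ← C_1, ← C_neg, coeff_X_add_C_pow]
  have h : (-1 : k) ^ (m + 1 - m) * ((m + 1).choose m : ℕ) = -(m + 1) := by simp
  rw [h, neg_ne_zero]
  exact hm.cast_add_one_ne_zero

theorem natDegree_sub_mul_X_pow (hm : IsFrobeniusIndex k m) (c : k) :
    (X ^ (2 * m + 1) - X - C c * X ^ (m + 1) : k[X]).natDegree = 2 * m + 1 := by
  have h2 := hm.two_le
  rw [natDegree_sub_eq_left_of_natDegree_lt, hm.natDegree_affineParam_two]
  rw [hm.natDegree_affineParam_two]
  exact (natDegree_C_mul_X_pow_le _ _).trans_lt (by omega)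

end IsFrobeniusIndex

theorem vec_eq_single_one : (![0, 1, 0] : Fin 3 → k) = Pi.single 1 1 := by
  funext i
  fin_cases i <;> simp

theorem vec_eq_single_zero : (![1, 0, 0] : Fin 3 → k) = Pi.single 0 1 := by
  funext i
  fin_cases i <;> simp

namespace PlaneCurve

variable {C : PlaneCurve k} [IsAlgClosed k]

theorem galoisPoint_mk_iff (hm : IsFrobeniusIndex k m)
    (hker : RingHom.ker (paramHom k m) = Ideal.span {C.poly}) {i₀ i₁ i₂ : Fin 3} (h01 : i₀ ≠ i₁)
    (h02 : i₀ ≠ i₂) (h12 : i₁ ≠ i₂) {v : Fin 3 → k} (hv : v i₀ = 1) (hv0 : v ≠ 0) {f g : k[X]}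
    (hf : affineParam k m i₁ - Polynomial.C (v i₁) * affineParam k m i₀ = f)
    (hg : affineParam k m i₂ - Polynomial.C (v i₂) * affineParam k m i₀ = g) (hg0 : g ≠ 0) :
    (C.IsGaloisPoint (Projectivization.mk k v hv0) ↔ IsGalois
      k⟮algebraMap k[X] (RatFunc k) f / algebraMap k[X] (RatFunc k) g⟯ (RatFunc k)) ∧
    Nonempty (C.GaloisGroup (Projectivization.mk k v hv0) ≃* (RatFunc k ≃ₐ[
      k⟮algebraMap k[X] (RatFunc k) f / algebraMap k[X] (RatFunc k) g⟯] RatFunc k)) :=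
  IntermediateField.galois_map_algEquiv _
    (map_projectionField hm hker h01 h02 h12 hv hv0 hf hg hg0)

theorem isInnerGaloisPoint_pt010 (hm : IsFrobeniusIndex k m)
    (hker : RingHom.ker (paramHom k m) = Ideal.span {C.poly}) :
    C.IsInnerGaloisPoint (pt010 k) ∧
      Nonempty (C.GaloisGroup (pt010 k) ≃* DihedralGroup m) := by
  obtain ⟨h1, ⟨e⟩⟩ := galoisPoint_mk_iff hm hker (i₀ := 1) (i₁ := 0) (i₂ := 2) (by decide)
    (by decide) (by decide) (v := ![0, 1, 0]) rfl (by simp) (f := X ^ (m + 1))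
    (g := X ^ (2 * m + 1) - X) (by simp) (by simp) hm.affineParam_two_ne_zero
  obtain ⟨h2, ⟨f⟩⟩ := hm.isGalois_zero_div_two
  refine ⟨⟨h1.2 h2, ?_⟩, ⟨e.trans f⟩⟩
  rw [pt010, isSmoothPoint_mk_iff, vec_eq_single_one]
  exact ⟨eval_single_one_poly hker, exists_pderiv_single_one_ne_zero hm hker⟩

theorem isInnerGaloisPoint_pt100 (hm : IsFrobeniusIndex k m)
    (hker : RingHom.ker (paramHom k m) = Ideal.span {C.poly}) :
    C.IsInnerGaloisPoint (pt100 k) ∧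
      Nonempty (C.GaloisGroup (pt100 k) ≃* DihedralGroup m) := by
  obtain ⟨h1, ⟨e⟩⟩ := galoisPoint_mk_iff hm hker (i₀ := 0) (i₁ := 1) (i₂ := 2) (by decide)
    (by decide) (by decide) (v := ![1, 0, 0]) rfl (by simp) (f := (X - 1) ^ (m + 1))
    (g := X ^ (2 * m + 1) - X) (by simp) (by simp) hm.affineParam_two_ne_zero
  obtain ⟨h2, ⟨f⟩⟩ := hm.isGalois_one_div_two
  refine ⟨⟨h1.2 h2, ?_⟩, ⟨e.trans f⟩⟩
  rw [pt100, isSmoothPoint_mk_iff, vec_eq_single_zero]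
  exact ⟨eval_single_zero_poly hker, exists_pderiv_single_zero_ne_zero hm hker⟩

/-- A point off the coordinate axes is not an inner Galois point. -/
theorem not_isInnerGaloisPoint_of_ne_zero (hm : IsFrobeniusIndex k m)
    (hker : RingHom.ker (paramHom k m) = Ideal.span {C.poly}) {v : Fin 3 → k} (hv : v 0 = 1)
    (hv1 : v 1 ≠ 0) (hv0 : v ≠ 0) : ¬ C.IsInnerGaloisPoint (Projectivization.mk k v hv0) := by
  rintro ⟨hG, hsm⟩
  rw [isSmoothPoint_mk_iff] at hsm
  have h2 := hm.two_le
  have hgdeg := hm.natDegree_sub_mul_X_pow (v 2)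
  have hfle := natDegree_sub_one_pow_sub_le (m := m) (v 1)
  have hlef := hm.le_natDegree_sub_one_pow_sub (v 1)
  set f : k[X] := (X - 1) ^ (m + 1) - Polynomial.C (v 1) * X ^ (m + 1) with hf
  set g : k[X] := X ^ (2 * m + 1) - X - Polynomial.C (v 2) * X ^ (m + 1) with hg
  have hg0 : g ≠ 0 := by
    intro h
    rw [h, natDegree_zero] at hgdeg
    omega
  rw [(galoisPoint_mk_iff hm hker (i₀ := 0) (i₁ := 1) (i₂ := 2) (by decide)
    (by decide) (by decide) hv hv0 (f := f) (g := g) rfl rfl hg0).1] at hG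
  -- If `f` divides `g`, the projection has degree at most `m + 1`, contrary to smoothness.
  -- Otherwise a simple zero of `f / g` meets the zero of order at least `m` at infinity.
  by_cases hroot : ∀ c, f.eval c = 0 → g.eval c = 0
  · obtain ⟨b, hb⟩ := Polynomial.dvd_of_separable_of_isRoot
      (hm.separable_sub_one_pow_sub hv1) hroot
    have hbdeg : b.natDegree ≤ m + 1 := by
      rw [hb] at hg0
      have := congrArg natDegree hb
      rw [natDegree_mul (left_ne_zero_of_mul hg0) (right_ne_zero_of_mul hg0), hgdeg] at this
      change 2 * m + 1 = f.natDegree + b.natDegree at this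
      omega
    have := two_mul_le_of_smooth hm hker (i₀ := 0) (i₁ := 1) (i₂ := 2) (by decide) (by decide)
      (by decide) hv hsm.2 (c := f) (b₁ := 1) (b₂ := b) (D := m + 1) (mul_one f).symm hb
      (by simp) hbdeg
    omega
  · push Not at hroot
    obtain ⟨c, hc, hgc⟩ := hroot
    exact RatFunc.not_isGalois_of_simple_zero hc
      (hm.eval_derivative_sub_one_pow_sub_ne_zero hv1 hc) hgc (by omega) hG

/-- On the image, `t = 0` gives the singular point `(0:0:1)`, while `s = 0` and `s = t` give the two
known points; elsewhere the first two coordinates are nonzero, and the first is scaled to 1. -/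
theorem eq_of_isInnerGaloisPoint (hm : IsFrobeniusIndex k m) (hq : Odd (2 * m + 1))
    (hker : RingHom.ker (paramHom k m) = Ideal.span {C.poly})
    {P : Projectivization k (Fin 3 → k)} (hP : C.IsInnerGaloisPoint P) :
    P = pt010 k ∨ P = pt100 k := by
  have h2 := hm.two_le
  have h1 : (2 * m + 1 + 1) / 2 = m + 1 := by omega
  have h1' : (2 * m + 1 - 1) / 2 = m := by omega
  have hmem := hP.2.1
  rw [points_eq_of_ker_eq (by omega) hq hker] at hmem
  obtain ⟨Q, rfl⟩ := hmem
  induction Q using Projectivization.ind with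
  | h w hw =>
    rw [phi2_mk] at hP ⊢
    by_cases hw1 : w 1 = 0
    · have heq : Projectivization.mk k (phi2Vec (2 * m + 1) w) (phi2Vec_ne_zero hq hw) =
          Projectivization.mk k (Pi.single 2 1) (by simp) := by
        rw [Projectivization.mk_eq_mk_iff']
        refine ⟨w 0 ^ (2 * m + 1), ?_⟩
        funext i
        fin_cases i <;> simp [phi2Vec, h1, hw1, zero_pow (show m ≠ 0 by omega),
          zero_pow (show 2 * m ≠ 0 by omega)]
      rw [heq] at hP
      obtain ⟨j, hj⟩ := ((isSmoothPoint_mk_iff C _ _).1 hP.2).2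
      exact absurd (pderiv_single_two_eq_zero hm hker j) hj
    · by_cases hx : w 0 = 0
      · left
        rw [pt010, Projectivization.mk_eq_mk_iff']
        refine ⟨(-w 1) ^ (m + 1) * w 1 ^ m, ?_⟩
        funext i
        fin_cases i <;> simp [phi2Vec, h1, hx]
      by_cases hy : w 0 - w 1 = 0
      · right
        rw [pt100, Projectivization.mk_eq_mk_iff']
        refine ⟨w 1 ^ (m + 1) * w 1 ^ m, ?_⟩
        have := sub_eq_zero.1 hy
        funext i
        fin_cases i <;> simp [phi2Vec, h1, this]
        ring
      · exfalso
        set u := phi2Vec (2 * m + 1) w with hu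
        have hu0 : u 0 ≠ 0 := by
          simpa [hu, phi2Vec, h1, h1'] using ⟨hx, fun h => absurd h hw1⟩
        have hu1 : u 1 ≠ 0 := by
          simpa [hu, phi2Vec, h1, h1'] using ⟨hy, fun h => absurd h hw1⟩
        have hne : (u 0)⁻¹ • u ≠ 0 :=
          smul_ne_zero (inv_ne_zero hu0) (phi2Vec_ne_zero hq hw)
        have heq : Projectivization.mk k u (phi2Vec_ne_zero hq hw) =
            Projectivization.mk k ((u 0)⁻¹ • u) hne := by
          rw [Projectivization.mk_eq_mk_iff']
          exact ⟨u 0, smul_inv_smul₀ hu0 u⟩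
        rw [heq] at hP
        exact not_isInnerGaloisPoint_of_ne_zero hm hker (by simp [hu0]) (by simp [hu0, hu1]) hne hP

end PlaneCurve

theorem pt010_eq_phi2 (hq : Odd (2 * m + 1)) : pt010 k = phi2 hq (pt01 k) := by
  have h1 : (2 * m + 1 + 1) / 2 = m + 1 := by omega
  rw [pt010, pt01, phi2_mk, Projectivization.mk_eq_mk_iff']
  refine ⟨(-1) ^ (m + 1), ?_⟩
  have h : ((-1 : k) ^ (m + 1)) * (-1) ^ (m + 1) = 1 := by rw [← mul_pow]; simp
  funext i
  fin_cases i <;> simp [phi2Vec, h1, h]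

theorem pt100_eq_phi2 (hq : Odd (2 * m + 1)) : pt100 k = phi2 hq (pt11 k) := by
  have h1 : (2 * m + 1 + 1) / 2 = m + 1 := by omega
  rw [pt100, pt11, phi2_mk, Projectivization.mk_eq_mk_iff']
  refine ⟨1, ?_⟩
  funext i
  fin_cases i <;> simp [phi2Vec, h1]

theorem pt010_ne_pt100 : pt010 k ≠ pt100 k := by
  rw [pt010, pt100, Ne, Projectivization.mk_eq_mk_iff']
  rintro ⟨c, hc⟩
  simpa using congrFun hc 1

theorem isFrobeniusIndex_of_eq_prime_pow {p : ℕ} [CharP k p] (hp : p.Prime)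
    (hm : 2 ≤ m) (hq : ∃ n : ℕ, 2 * m + 1 = p ^ n) : IsFrobeniusIndex k m := by
  obtain ⟨n, hn⟩ := hq
  have := Fact.mk hp
  refine ⟨hm, ?_, ?_⟩
  · have hn0 : n ≠ 0 := by
      rintro rfl
      rw [pow_zero] at hn
      omega
    have h : ((2 * m + 1 : ℕ) : k) = 0 := by
      rw [hn, Nat.cast_pow, CharP.cast_eq_zero, zero_pow hn0]
    exact_mod_cast h
  · rw [hn, sub_pow_char_pow, one_pow]

end GaloisPoints

theorem theorem2 {k : Type*} [Field k] [IsAlgClosed k] {p q : ℕ} [CharP k p]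
    (hp : p.Prime) (hp3 : 3 ≤ p) (hq : ∃ n : ℕ, q = p ^ n) (hq5 : 5 ≤ q) :
    -- the image of `φ₂` is an irreducible plane curve
    (∃ C₂ : PlaneCurve k, C₂.points = Set.range (phi2 (k := k) (odd_of_eq_prime_pow hp hp3 hq))) ∧
    -- any such curve has the following properties (its equation is unique up to a scalar)
    ∀ C₂ : PlaneCurve k,
      C₂.points = Set.range (phi2 (k := k) (odd_of_eq_prime_pow hp hp3 hq)) →
      C₂.degree = q ∧
      (pt010 k = phi2 (odd_of_eq_prime_pow hp hp3 hq) (pt01 k) ∧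
        C₂.IsInnerGaloisPoint (pt010 k) ∧
        Nonempty (C₂.GaloisGroup (pt010 k) ≃* DihedralGroup ((q - 1) / 2))) ∧
      (pt100 k = phi2 (odd_of_eq_prime_pow hp hp3 hq) (pt11 k) ∧
        C₂.IsInnerGaloisPoint (pt100 k) ∧
        Nonempty (C₂.GaloisGroup (pt100 k) ≃* DihedralGroup ((q - 1) / 2))) ∧
      {P | C₂.IsInnerGaloisPoint P} = {pt010 k, pt100 k} ∧
      {P | C₂.IsInnerGaloisPoint P}.ncard = 2 := by
  have hodd := odd_of_eq_prime_pow hp hp3 hq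
  obtain ⟨m, rfl⟩ := hodd
  have hm : IsFrobeniusIndex k m := isFrobeniusIndex_of_eq_prime_pow hp (by omega) hq
  have h2 := hm.two_le
  have hdiv : (2 * m + 1 - 1) / 2 = m := by omega
  refine ⟨?_, fun C hC => ?_⟩
  · obtain ⟨C, hker⟩ := exists_planeCurve_ker_eq (k := k) (m := m) (by omega)
    exact ⟨C, PlaneCurve.points_eq_of_ker_eq (by omega) _ hker⟩
  · have hker := PlaneCurve.ker_eq_of_points_eq (by omega) _ hC
    have h₁ := PlaneCurve.isInnerGaloisPoint_pt010 hm hker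
    have h₂ := PlaneCurve.isInnerGaloisPoint_pt100 hm hker
    have hset : {P | C.IsInnerGaloisPoint P} = {pt010 k, pt100 k} := by
      ext P
      constructor
      · exact fun hP => PlaneCurve.eq_of_isInnerGaloisPoint hm ⟨m, rfl⟩ hker hP
      · rintro (rfl | rfl)
        · exact h₁.1
        · exact h₂.1
    rw [hdiv]
    refine ⟨PlaneCurve.totalDegree_poly hm hker, ⟨pt010_eq_phi2 _, h₁⟩, ⟨pt100_eq_phi2 _, h₂⟩,
      hset, ?_⟩
    rw [hset, Set.ncard_pair pt010_ne_pt100]
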